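/- Let $a_1,\dots,a_n\in\mathbb R^2$ be pairwise distinct, let $D\subset\mathbb R^2$ be a compact convex polygon with nonempty interior, let $\alpha>0$, let $\varrho\colon D\to[0,\infty)$ be continuous, and let $u_d$ be the measure on $D$ with Lebesgue density $\varrho$. Let $g\colon\mathbb R^n\to\mathbb R$ be convex and twice continuously differentiable. For $\xi\in\mathbb R^n$ put $$D_i(\xi)=\{x\in\operatorname{int}D : a_i^\top x-\xi_i>a_j^\top x-\xi_j\ \text{for all } j\ne i\},\qquad \tilde u(\xi)=\bigl(u_d(D_1(\xi)),\dots,u_d(D_n(\xi))\bigr)^\top,$$ $$r(\xi)=A+\tfrac1\alpha\nabla g(\tilde u(\xi))-\xi,\qquad A=\tfrac12\bigl(|a_1|^2,\dots,|a_n|^2\bigr)^\top .$$ Define $\Theta(\xi)\in\mathbb R^{n\times n}$ as follows. If $u_d(D_i(\xi))=0$, the $i$-th row of $\Theta(\xi)$ is zero. If $u_d(D_i(\xi))>0$, then for $k\ne i$ $$\Theta_{ik}(\xi)=\frac1{|a_k-a_i|}\int_{\overline{D_i(\xi)}\cap\overline{D_k(\xi)}}\varrho\,\mathrm d\mathcal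 H^1,\qquad \Theta_{ii}(\xi)=-\sum_{k\ne i}\Theta_{ik}(\xi),$$ where $\mathcal H^1$ is the one-dimensional Hausdorff measure (so only regions $D_k(\xi)$ sharing an edge with $D_i(\xi)$ contribute). Let $$Dr(\xi)=\tfrac1\alpha\nabla^2g(\tilde u(\xi))\,\Theta(\xi)-I .$$ Let $\bar\xi\in\mathbb R^n$ satisfy $r(\bar\xi)=0$. Then there exists $\delta>0$ such that, for every $\xi_0\in\mathbb R^n$ with $|\xi_0-\bar\xi|\le\delta$, the iteration $$\xi_{k+1}=\xi_k-Dr(\xi_k)^{-1}r(\xi_k),\qquad k=0,1,2,\dots,$$ is well defined (each $Dr(\xi_k)$ is invertible) and $(\xi_k)$ converges q-superlinearly to $\bar\xi$, i.e. $\xi_k\to\bar\xi$ and $|\xi_{k+1}-\bar\xi|=o(|\xi_k-\bar\xi|)$ as $k\to\infty$. -/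

import Mathlib

open Set Filter Topology MeasureTheory

noncomputable section

namespace SemiDiscrete

/-- A compact convex polygon with nonempty interior: a compact set with nonempty interior
that is the intersection of finitely many closed half-planes. -/
def IsConvexPolygon (D : Set (EuclideanSpace ℝ (Fin 2))) : Prop :=
  IsCompact D ∧ (interior D).Nonempty ∧
    ∃ (m : ℕ) (ν : Fin m → EuclideanSpace ℝ (Fin 2)) (ζ : Fin m → ℝ),
      D = {x | ∀ i, inner ℝ (ν i) x ≤ ζ i}

/-- The dominating region `D_i(ξ)`. -/
def region {n : ℕ} (D : Set (EuclideanSpace ℝ (Fin 2)))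
    (a : Fin n → EuclideanSpace ℝ (Fin 2)) (ξ : EuclideanSpace ℝ (Fin n)) (i : Fin n) :
    Set (EuclideanSpace ℝ (Fin 2)) :=
  {x | x ∈ interior D ∧ ∀ j, j ≠ i → inner ℝ (a j) x - ξ j < inner ℝ (a i) x - ξ i}

/-- The vector `ũ(ξ) = (u_d(D_1(ξ)), …, u_d(D_n(ξ)))`. -/
def uTilde {n : ℕ} (D : Set (EuclideanSpace ℝ (Fin 2)))
    (a : Fin n → EuclideanSpace ℝ (Fin 2)) (ud : Measure (EuclideanSpace ℝ (Fin 2)))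
    (ξ : EuclideanSpace ℝ (Fin n)) : EuclideanSpace ℝ (Fin n) :=
  WithLp.toLp 2 fun i => (ud (region D a ξ i)).toReal

/-- The residual `r(ξ) = A + (1/α) ∇g(ũ(ξ)) - ξ` with `A_i = |a_i|² / 2`. -/
def residual {n : ℕ} (D : Set (EuclideanSpace ℝ (Fin 2)))
    (a : Fin n → EuclideanSpace ℝ (Fin 2)) (ud : Measure (EuclideanSpace ℝ (Fin 2)))
    (g : EuclideanSpace ℝ (Fin n) → ℝ) (α : ℝ)
    (ξ : EuclideanSpace ℝ (Fin n)) : EuclideanSpace ℝ (Fin n) :=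
  WithLp.toLp 2 (fun i => ‖a i‖ ^ 2 / 2) + (1 / α) • gradient g (uTilde D a ud ξ) - ξ

/-- The common edge of the regions `D_i(ξ)` and `D_j(ξ)`, for `i ≠ j`: a segment if the two
regions are adjacent, and otherwise a set with at most one point, which is `μH[1]`-null. -/
def edge {n : ℕ} (D : Set (EuclideanSpace ℝ (Fin 2)))
    (a : Fin n → EuclideanSpace ℝ (Fin 2)) (ξ : EuclideanSpace ℝ (Fin n)) (i j : Fin n) :
    Set (EuclideanSpace ℝ (Fin 2)) :=
  closure (region D a ξ i) ∩ closure (region D a ξ j)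

/-- The weighted edge length: the integral of `ϱ` over the common edge of `D_i(ξ)` and
`D_j(ξ)` with respect to the one-dimensional Hausdorff measure, divided by `|a_j - a_i|`. -/
def edgeWeight {n : ℕ} (D : Set (EuclideanSpace ℝ (Fin 2)))
    (a : Fin n → EuclideanSpace ℝ (Fin 2)) (ϱ : EuclideanSpace ℝ (Fin 2) → ℝ)
    (ξ : EuclideanSpace ℝ (Fin n)) (i j : Fin n) : ℝ :=
  (1 / ‖a j - a i‖) *
    ∫ x in edge D a ξ i j, ϱ x ∂(Measure.hausdorffMeasure 1)

open Classical in
/-- The matrix `Θ(ξ)`. Its `i`-th row is zero if `u_d(D_i(ξ)) = 0`. Otherwise the entries off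
the diagonal are the weighted edge lengths, and the entries of the row sum to zero. -/
def Theta {n : ℕ} (D : Set (EuclideanSpace ℝ (Fin 2)))
    (a : Fin n → EuclideanSpace ℝ (Fin 2)) (ud : Measure (EuclideanSpace ℝ (Fin 2)))
    (ϱ : EuclideanSpace ℝ (Fin 2) → ℝ) (ξ : EuclideanSpace ℝ (Fin n)) :
    Matrix (Fin n) (Fin n) ℝ :=
  Matrix.of fun i k =>
    if 0 < ud (region D a ξ i) then
      if k = i then -∑ j ∈ Finset.univ.erase i, edgeWeight D a ϱ ξ i j
      else edgeWeight D a ϱ ξ i k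
    else 0

/-- The Newton derivative `Dr(ξ) = (1/α) ∇²g(ũ(ξ)) Θ(ξ) - I`, as a linear operator on `ℝⁿ`;
the Hessian is the derivative of the gradient. -/
def Dr {n : ℕ} (D : Set (EuclideanSpace ℝ (Fin 2)))
    (a : Fin n → EuclideanSpace ℝ (Fin 2)) (ud : Measure (EuclideanSpace ℝ (Fin 2)))
    (ϱ : EuclideanSpace ℝ (Fin 2) → ℝ) (g : EuclideanSpace ℝ (Fin n) → ℝ) (α : ℝ)
    (ξ : EuclideanSpace ℝ (Fin n)) : EuclideanSpace ℝ (Fin n) →L[ℝ] EuclideanSpace ℝ (Fin n) :=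
  (1 / α) • (fderiv ℝ (gradient g) (uTilde D a ud ξ)).comp
      (Matrix.toEuclideanCLM (𝕜 := ℝ) (Theta D a ud ϱ ξ))
    - ContinuousLinearMap.id ℝ (EuclideanSpace ℝ (Fin n))

/-- The `k`-th iterate of `ξ ↦ ξ - Dr(ξ)⁻¹ r(ξ)` from the starting point `ξ₀`. -/
def newtonSeq {n : ℕ} (D : Set (EuclideanSpace ℝ (Fin 2)))
    (a : Fin n → EuclideanSpace ℝ (Fin 2)) (ud : Measure (EuclideanSpace ℝ (Fin 2)))
    (ϱ : EuclideanSpace ℝ (Fin 2) → ℝ) (g : EuclideanSpace ℝ (Fin n) → ℝ) (α : ℝ)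
    (ξ₀ : EuclideanSpace ℝ (Fin n)) : ℕ → EuclideanSpace ℝ (Fin n)
  | 0 => ξ₀
  | k + 1 =>
    newtonSeq D a ud ϱ g α ξ₀ k -
      (Dr D a ud ϱ g α (newtonSeq D a ud ϱ g α ξ₀ k)).inverse
        (residual D a ud g α (newtonSeq D a ud ϱ g α ξ₀ k))

/-- q-superlinear convergence: `x_k → x̄` and `|x_{k+1} - x̄| = o(|x_k - x̄|)`. -/
def ConvergesQSuperlinearly {E : Type*} [NormedAddCommGroup E] (x : ℕ → E) (xbar : E) : Prop :=
  Tendsto x atTop (𝓝 xbar) ∧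
    (fun k => x (k + 1) - xbar) =o[atTop] (fun k => x k - xbar)

end SemiDiscrete

end

noncomputable section

namespace SemiDiscrete

/-! Newton's method converges q-superlinearly as soon as, near `ξbar`, `r ξ - Dr ξ (ξ - ξbar) = o(ξ
- ξbar)` with the derivative taken at the moving point `ξ`, and `Dr ξ` has a uniformly bounded
inverse (`newton_convergesQSuperlinearly`). Classical differentiability of `r` is not needed, which
matters because regions may vanish at or near `ξbar`.

Expansion. A region is an open polygon whose sides keep their directions while their offsets move
with `ξ`. Pushing a side outward adds the integral of the masses of the swept lines (Fubini), and
these line masses are continuous in the offsets once parallel constraints are left out. Two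
degeneracies remain. Opposite sides may cross: then the polygon is empty and the side masses at the
moving point are set to zero; otherwise `c` and `c₀` are both compared with `c ⊔ c₀`, so that sides
only move outward (`polyMass_sub_isLittleO`). Several constraints may share a direction or a line:
only the sharpest in each direction counts, one that is sharpest at the moving point was already
sharpest at the base point, and among the sites that define one line only the farthest has an edge
there (`sum_dirClass_edgeWeight`). The chain rule carries the expansion over to `r`.

Inverse. `-Theta` is the Laplacian of a graph with symmetric, uniformly bounded weights, so `‖Θ v‖²
≤ -L ⟪Θ v, v⟫`. With `p = Θ v` and `w = Dr v`, pairing `w` with `p` lets the positive semidefinite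
Hessian term be dropped; this bounds `p`, and then `v`, by `w` (`norm_le_of_cocoercive`). The
Hessian may be singular and the product with `Θ` nonsymmetric. -/

/-- The Euclidean plane. -/
abbrev Plane : Type := EuclideanSpace ℝ (Fin 2)

/-! ### Rotated coordinates in the plane -/

/-- The vector `θ` turned by a right angle. -/
def perp (θ : Plane) : Plane := !₂[-θ 1, θ 0]

lemma inner_eq_coord (x y : Plane) : inner ℝ x y = x 0 * y 0 + x 1 * y 1 := by
  simp [PiLp.inner_apply, Fin.sum_univ_two, mul_comm]

lemma norm_sq_eq_coord (x : Plane) : ‖x‖ ^ 2 = x 0 ^ 2 + x 1 ^ 2 := by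
  rw [← real_inner_self_eq_norm_sq, inner_eq_coord]; ring

lemma coord_sq_add_sq_of_norm_one {θ : Plane} (h : ‖θ‖ = 1) : θ 0 ^ 2 + θ 1 ^ 2 = 1 := by
  rw [← norm_sq_eq_coord, h]; norm_num

lemma norm_perp (θ : Plane) : ‖perp θ‖ = ‖θ‖ := by
  have h : ‖perp θ‖ ^ 2 = ‖θ‖ ^ 2 := by
    rw [norm_sq_eq_coord, norm_sq_eq_coord]; simp [perp]; ring
  exact (sq_eq_sq₀ (norm_nonneg _) (norm_nonneg _)).1 h

lemma inner_perp_self (θ : Plane) : inner ℝ θ (perp θ) = 0 := by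
  rw [inner_eq_coord]; simp [perp]; ring

lemma eq_or_eq_neg_of_inner_perp_eq_zero {θ θ' : Plane} (h : ‖θ‖ = 1) (h' : ‖θ'‖ = 1)
    (hp : inner ℝ θ' (perp θ) = 0) : θ' = θ ∨ θ' = -θ := by
  have h1 := coord_sq_add_sq_of_norm_one h
  rw [inner_eq_coord] at hp
  simp only [perp, PiLp.toLp_apply, Matrix.cons_val_zero, Matrix.cons_val_one] at hp
  have key : θ' = (θ 0 * θ' 0 + θ 1 * θ' 1) • θ := by
    ext i
    fin_cases i
    · simp only [Fin.zero_eta, PiLp.smul_apply, smul_eq_mul]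
      linear_combination (-θ' 0) * h1 - θ 1 * hp
    · simp only [Fin.mk_one, PiLp.smul_apply, smul_eq_mul]
      linear_combination (-θ' 1) * h1 + θ 0 * hp
  have hl : |θ 0 * θ' 0 + θ 1 * θ' 1| = 1 := by
    have := congrArg norm key
    rw [norm_smul, h, h', mul_one, Real.norm_eq_abs] at this
    exact this.symm
  rcases abs_eq (zero_le_one) |>.1 hl with hl | hl <;> rw [hl] at key
  · left; simpa using key
  · right; simpa using key

/-- The point with coordinates `(p.1, p.2)` in the frame `(θ, perp θ)`. -/
def frame (θ : Plane) (p : ℝ × ℝ) : Plane := p.1 • θ + p.2 • perp θ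

lemma continuous_frame (θ : Plane) : Continuous (frame θ) := by
  unfold frame; fun_prop

lemma inner_frame {θ : Plane} (h : ‖θ‖ = 1) (p : ℝ × ℝ) : inner ℝ θ (frame θ p) = p.1 := by
  simp [frame, inner_add_right, inner_smul_right, inner_perp_self, h]

lemma norm_sq_frame {θ : Plane} (h : ‖θ‖ = 1) (p : ℝ × ℝ) :
    ‖frame θ p‖ ^ 2 = p.1 ^ 2 + p.2 ^ 2 := by
  have h1 := coord_sq_add_sq_of_norm_one h
  rw [norm_sq_eq_coord]
  simp [frame, perp]
  linear_combination (p.1 ^ 2 + p.2 ^ 2) * h1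

lemma abs_snd_le_norm_frame {θ : Plane} (h : ‖θ‖ = 1) (p : ℝ × ℝ) : |p.2| ≤ ‖frame θ p‖ := by
  refine abs_le_of_sq_le_sq ?_ (norm_nonneg _)
  rw [norm_sq_frame h]; nlinarith [sq_nonneg p.1]

lemma eq_frame {θ : Plane} (h : ‖θ‖ = 1) (x : Plane) :
    x = frame θ (inner ℝ θ x, inner ℝ (perp θ) x) := by
  have h1 := coord_sq_add_sq_of_norm_one h
  ext i
  fin_cases i
  · simp [frame, perp, inner_eq_coord]
    linear_combination (-x 0) * h1
  · simp [frame, perp, inner_eq_coord]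
    linear_combination (-x 1) * h1

lemma isometry_frame_line {θ : Plane} (h : ‖θ‖ = 1) (t : ℝ) : Isometry fun s => frame θ (t, s) := by
  refine Isometry.of_dist_eq fun s s' => ?_
  have : frame θ (t, s) - frame θ (t, s') = (s - s') • perp θ := by
    simp only [frame, sub_smul]; abel
  rw [dist_eq_norm, this, norm_smul, norm_perp, h, mul_one, Real.norm_eq_abs, Real.dist_eq]

lemma range_frame_line {θ : Plane} (h : ‖θ‖ = 1) (t : ℝ) :
    range (fun s => frame θ (t, s)) = {x | inner ℝ θ x = t} := by
  ext x
  constructor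
  · rintro ⟨s, rfl⟩
    exact inner_frame h _
  · intro hx
    refine ⟨inner ℝ (perp θ) x, ?_⟩
    conv_rhs => rw [eq_frame h x]
    rw [show inner ℝ θ x = t from hx]

lemma orthonormal_frame {θ : Plane} (h : ‖θ‖ = 1) : Orthonormal ℝ ![θ, perp θ] := by
  refine ⟨fun i => ?_, fun i j hij => ?_⟩
  · fin_cases i <;> simp [norm_perp, h]
  · fin_cases i <;> fin_cases j
    · exact absurd rfl hij
    · exact inner_perp_self θ
    · show inner ℝ (perp θ) θ = 0
      rw [real_inner_comm]; exact inner_perp_self θ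
    · exact absurd rfl hij

/-- The coordinates in the frame `(θ, perp θ)` as a measurable equivalence. -/
def frameEquiv (θ : Plane) (h : ‖θ‖ = 1) : ℝ × ℝ ≃ᵐ Plane where
  toFun := frame θ
  invFun x := (inner ℝ θ x, inner ℝ (perp θ) x)
  left_inv p := by
    have h' : inner ℝ (perp θ) (frame θ p) = p.2 := by
      rw [frame, inner_add_right, inner_smul_right, inner_smul_right, real_inner_comm,
        inner_perp_self, real_inner_self_eq_norm_sq, norm_perp, h]
      ring
    exact Prod.ext (inner_frame h p) h'
  right_inv x := (eq_frame h x).symm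
  measurable_toFun := (continuous_frame θ).measurable
  measurable_invFun := by
    have hc : Continuous fun x : Plane => (inner ℝ θ x, inner ℝ (perp θ) x) := by fun_prop
    exact hc.measurable

lemma measurePreserving_frame {θ : Plane} (h : ‖θ‖ = 1) :
    MeasurePreserving (frame θ) (volume : Measure (ℝ × ℝ)) volume := by
  have hon := orthonormal_frame h
  have hcard : Fintype.card (Fin 2) = Module.finrank ℝ Plane := by simp
  have hspan : ⊤ ≤ Submodule.span ℝ (range ![θ, perp θ]) :=
    (hon.linearIndependent.span_eq_top_of_card_eq_finrank' hcard).ge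
  let b := OrthonormalBasis.mk hon hspan
  have h1 := b.measurePreserving_repr
  have h2 := PiLp.volume_preserving_ofLp (Fin 2)
  have h3 := volume_preserving_finTwoArrow ℝ
  have h4 := h3.comp (h2.comp h1)
  have h5 : (MeasurableEquiv.finTwoArrow ∘ WithLp.ofLp ∘ b.repr : Plane → ℝ × ℝ)
      = (frameEquiv θ h).symm := by
    funext x
    show (b.repr x 0, b.repr x 1) = (inner ℝ θ x, inner ℝ (perp θ) x)
    rw [b.repr_apply_apply, b.repr_apply_apply]
    simp [b]
  have h4' : MeasurePreserving (frameEquiv θ h).symm volume volume := by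
    rw [← h5]; exact h4
  exact h4'.symm

lemma measurableEmbedding_frame {θ : Plane} (h : ‖θ‖ = 1) : MeasurableEmbedding (frame θ) :=
  (frameEquiv θ h).measurableEmbedding

/-- Integration over a subset of a line with respect to the Hausdorff measure. -/
lemma setIntegral_hausdorff_line {θ : Plane} (h : ‖θ‖ = 1) (t : ℝ) (f : Plane → ℝ) (S : Set Plane)
    (hS : S ⊆ {x | inner ℝ θ x = t}) :
    ∫ x in S, f x ∂(Measure.hausdorffMeasure 1)
      = ∫ s in (fun s => frame θ (t, s)) ⁻¹' S, f (frame θ (t, s)) := by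
  have hiso := isometry_frame_line h t
  have hemb : MeasurableEmbedding (fun s => frame θ (t, s)) :=
    hiso.isClosedEmbedding.measurableEmbedding
  rw [← hausdorffMeasure_real, ← hemb.setIntegral_map,
    hiso.map_hausdorffMeasure (Or.inl zero_le_one), range_frame_line h t,
    Measure.restrict_restrict_of_subset hS]

/-! ### The mass of a polygon as a function of its offsets -/

section Polygon

variable {ι : Type*} [Fintype ι]

/-- The open polygon with normals `θ` and offsets `c`. -/
def poly (θ : ι → Plane) (c : ι → ℝ) : Set Plane := {x | ∀ m, inner ℝ (θ m) x < c m}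

/-- The part of the plane cut out by the constraints that are not parallel to the `m`-th one. -/
def sideCut (θ : ι → Plane) (m : ι) (c : ι → ℝ) : Set Plane :=
  {x | ∀ l, θ l ≠ θ m → θ l ≠ -θ m → inner ℝ (θ l) x < c l}

/-- The mass of the open polygon with normals `θ` and offsets `c`. -/
def polyMass (ρ : Plane → ℝ) (θ : ι → Plane) (c : ι → ℝ) : ℝ := ∫ x in poly θ c, ρ x

/-- The integral of `ρ` over the part of the `m`-th bounding line that satisfies the constraints
transversal to it. -/
def lineMass (ρ : Plane → ℝ) (θ : ι → Plane) (m : ι) (c : ι → ℝ) : ℝ :=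
  ∫ s, (sideCut θ m c).indicator ρ (frame (θ m) (c m, s))

lemma isOpen_poly (θ : ι → Plane) (c : ι → ℝ) : IsOpen (poly θ c) := by
  simp only [poly, ofPred_forall]
  exact isOpen_iInter_of_finite fun m =>
    isOpen_lt (continuous_const.inner continuous_id) continuous_const

lemma isOpen_sideCut (θ : ι → Plane) (m : ι) (c : ι → ℝ) : IsOpen (sideCut θ m c) := by
  simp only [sideCut, ofPred_forall]
  refine isOpen_iInter_of_finite fun m' => isOpen_iInter_of_finite fun _ =>
    isOpen_iInter_of_finite fun _ => ?_
  exact isOpen_lt (continuous_const.inner continuous_id) continuous_const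

lemma exists_bound_of_hasCompactSupport {ρ : Plane → ℝ} (hρ : Continuous ρ)
    (hs : HasCompactSupport ρ) :
    ∃ M R : ℝ, 0 ≤ M ∧ 0 ≤ R ∧ (∀ x, |ρ x| ≤ M) ∧ ∀ x, ρ x ≠ 0 → ‖x‖ ≤ R := by
  obtain ⟨M, hM⟩ := hs.exists_bound_of_continuous hρ
  obtain ⟨R, hR⟩ := hs.isBounded.exists_norm_le
  refine ⟨M, |R|, (norm_nonneg _).trans (hM 0), abs_nonneg _, hM, fun x hx => ?_⟩
  exact (hR x (subset_tsupport ρ hx)).trans (le_abs_self R)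

lemma abs_indicator_frame_le {ρ : Plane → ℝ} {M R : ℝ} (hM0 : 0 ≤ M) (hM : ∀ x, |ρ x| ≤ M)
    (hR : ∀ x, ρ x ≠ 0 → ‖x‖ ≤ R) {θ : Plane} (h : ‖θ‖ = 1) (S : Set Plane) (t s : ℝ) :
    |S.indicator ρ (frame θ (t, s))| ≤ (Icc (-R) R).indicator (fun _ => M) s := by
  by_cases hx : S.indicator ρ (frame θ (t, s)) = 0
  · rw [hx, abs_zero]
    exact indicator_nonneg (fun _ _ => hM0) _
  · have hS : frame θ (t, s) ∈ S := mem_of_indicator_ne_zero hx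
    rw [indicator_of_mem hS] at hx ⊢
    have := (abs_snd_le_norm_frame h (t, s)).trans (hR _ hx)
    rw [indicator_of_mem (show s ∈ Icc (-R) R from abs_le.1 this)]
    exact hM _

lemma integrable_bound (M R : ℝ) :
    Integrable ((Icc (-R) R).indicator (fun _ => M)) (volume : Measure ℝ) := by
  rw [integrable_indicator_iff measurableSet_Icc]
  exact integrableOn_const (by simp)

/-- A transversal line meets the parametrized one in at most one point; the two directions `±θ` are
the parallel ones. -/
lemma ae_line_ne {θ θ' : Plane} (h : ‖θ‖ = 1) (h' : ‖θ'‖ = 1) (hne : θ' ≠ θ) (hne' : θ' ≠ -θ)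
    (t c : ℝ) : ∀ᵐ s : ℝ, inner ℝ θ' (frame θ (t, s)) ≠ c := by
  have hp : inner ℝ θ' (perp θ) ≠ 0 := fun hp =>
    (eq_or_eq_neg_of_inner_perp_eq_zero h h' hp).elim hne hne'
  have hsub : {s : ℝ | inner ℝ θ' (frame θ (t, s)) = c}.Subsingleton := by
    intro s hs s' hs'
    have e := hs.trans hs'.symm
    simp only [frame, inner_add_right, inner_smul_right, add_right_inj] at e
    exact mul_right_cancel₀ hp e
  rw [ae_iff]
  simpa using hsub.measure_zero volume

/-- Dominated convergence: for almost every `s` no transversal constraint is an equality at `c₀`, so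
membership in `sideCut` is locally constant there. A parallel constraint could switch off the whole
line at once, which is why `sideCut` omits it. -/
lemma continuous_lineMass {ρ : Plane → ℝ} (hρ : Continuous ρ) (hs : HasCompactSupport ρ)
    {θ : ι → Plane} (hθ : ∀ m, ‖θ m‖ = 1) (m : ι) : Continuous (lineMass ρ θ m) := by
  obtain ⟨M, R, hM0, -, hM, hR⟩ := exists_bound_of_hasCompactSupport hρ hs
  rw [continuous_iff_continuousAt]
  intro c₀
  refine continuousAt_of_dominated (bound := (Icc (-R) R).indicator (fun _ => M))
    (Eventually.of_forall fun c => ?_) (Eventually.of_forall fun c => ?_)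
    (integrable_bound M R) ?_
  · have h1 : Measurable ((sideCut θ m c).indicator ρ) :=
      hρ.measurable.indicator (isOpen_sideCut θ m c).measurableSet
    exact (h1.comp (isometry_frame_line (hθ m) (c m)).continuous.measurable).aestronglyMeasurable
  · exact Eventually.of_forall fun s => abs_indicator_frame_le hM0 hM hR (hθ m) _ _ _
  · have hae : ∀ᵐ s : ℝ, ∀ m', θ m' ≠ θ m → θ m' ≠ -θ m →
        inner ℝ (θ m') (frame (θ m) (c₀ m, s)) ≠ c₀ m' := by
      rw [ae_all_iff]
      intro m'
      by_cases h1 : θ m' = θ m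
      · simp [h1]
      by_cases h2 : θ m' = -θ m
      · simp [h2]
      filter_upwards [ae_line_ne (hθ m) (hθ m') h1 h2 (c₀ m) (c₀ m')] with s hs _ _ using hs
    filter_upwards [hae] with s hs'
    have hfr : Continuous fun c : ι → ℝ => frame (θ m) (c m, s) :=
      (continuous_frame _).comp (by fun_prop)
    have hin : ∀ m', Continuous fun c : ι → ℝ => inner ℝ (θ m') (frame (θ m) (c m, s)) :=
      fun m' => continuous_const.inner hfr
    by_cases hmem : frame (θ m) (c₀ m, s) ∈ sideCut θ m c₀
    · have hev : ∀ᶠ c in 𝓝 c₀, frame (θ m) (c m, s) ∈ sideCut θ m c := by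
        simp only [sideCut, mem_ofPred_eq, eventually_all]
        intro m' h1 h2
        exact (hin m').continuousAt.eventually_lt (continuous_apply m').continuousAt
          (hmem m' h1 h2)
      refine (hρ.comp hfr).continuousAt.congr ?_
      filter_upwards [hev] with c hc
      rw [indicator_of_mem hc]; rfl
    · have hmem' := hmem
      simp only [sideCut, mem_ofPred_eq, not_forall, not_lt] at hmem'
      obtain ⟨m', h1, h2, h3⟩ := hmem'
      have h4 := lt_of_le_of_ne h3 (hs' m' h1 h2).symm
      have hev : ∀ᶠ c in 𝓝 c₀, frame (θ m) (c m, s) ∉ sideCut θ m c := by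
        filter_upwards [(continuous_apply m').continuousAt.eventually_lt
          (hin m').continuousAt h4] with c hc hcm
        exact lt_asymm hc (hcm m' h1 h2)
      refine (continuousAt_const (y := (0 : ℝ))).congr ?_
      filter_upwards [hev] with c hc
      rw [indicator_of_notMem hc]

lemma integrable_of_compactSupport {ρ : Plane → ℝ} (hρ : Continuous ρ) (hs : HasCompactSupport ρ) :
    Integrable ρ := hρ.integrable_of_hasCompactSupport hs

open Classical in
/-- Moving one bounding line outwards: the gained mass is the integral of the line masses. -/
lemma polyMass_update_sub {ρ : Plane → ℝ} (hρ : Continuous ρ) (hs : HasCompactSupport ρ)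
    {θ : ι → Plane} (hθ : ∀ m, ‖θ m‖ = 1) (hinj : Function.Injective θ) (m : ι) (c : ι → ℝ)
    {t t' : ℝ} (htt' : t ≤ t') (hopp : ∀ m', θ m' = -θ m → -c m' ≤ t) :
    polyMass ρ θ (Function.update c m t') - polyMass ρ θ (Function.update c m t)
      = ∫ σ in t..t', lineMass ρ θ m (Function.update c m σ) := by
  have hint := integrable_of_compactSupport hρ hs
  set P := poly θ (Function.update c m t)
  set P' := poly θ (Function.update c m t')
  have hPm : MeasurableSet P := (isOpen_poly _ _).measurableSet
  have hPm' : MeasurableSet P' := (isOpen_poly _ _).measurableSet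
  have hsub : P ⊆ P' := by
    intro x hx m'
    refine (hx m').trans_le ?_
    by_cases h : m' = m
    · subst h; simpa using htt'
    · simp [h]
  have hmem : ∀ σ s, t < σ → σ < t' →
      (frame (θ m) (σ, s) ∈ P' \ P ↔ frame (θ m) (σ, s) ∈ sideCut θ m c) := by
    -- Between the two positions of the line, constraint `m` is settled, `hopp` settles the opposite
    -- one, and injectivity of `θ` leaves no other parallel constraint.
    intro σ s h1 h2
    constructor
    · rintro ⟨h3, -⟩ m' h4 -
      have h5 : m' ≠ m := fun h => h4 (by rw [h])
      simpa [h5] using h3 m'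
    · intro h3
      refine ⟨fun m' => ?_, fun h4 => ?_⟩
      · by_cases h5 : m' = m
        · subst h5
          rw [inner_frame (hθ _)]; simpa using h2
        · rw [Function.update_of_ne h5]
          by_cases h6 : θ m' = -θ m
          · rw [h6, inner_neg_left, inner_frame (hθ m)]
            linarith [hopp m' h6]
          · exact h3 m' (fun h => h5 (hinj h)) h6
      · have := h4 m
        rw [inner_frame (hθ m), Function.update_self] at this
        exact lt_asymm h1 this
  have hnot : ∀ σ s, (σ < t ∨ t' < σ) → frame (θ m) (σ, s) ∉ P' \ P := by
    rintro σ s h1 ⟨h2, h3⟩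
    have h4 := h2 m
    rw [inner_frame (hθ m), Function.update_self] at h4
    rcases h1 with h1 | h1
    · refine h3 fun m' => ?_
      by_cases h5 : m' = m
      · subst h5
        rw [inner_frame (hθ _), Function.update_self]; exact h1
      · have := h2 m'
        rwa [Function.update_of_ne h5] at this ⊢
    · exact lt_asymm h1 h4
  have hcut : ∀ σ, sideCut θ m (Function.update c m σ) = sideCut θ m c := by
    intro σ
    ext x
    refine forall_congr' fun m' => ?_
    by_cases h : m' = m
    · subst h; simp
    · rw [Function.update_of_ne h]
  have hind : Integrable ((P' \ P).indicator ρ) := hint.indicator (hPm'.diff hPm)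
  have hmp := measurePreserving_frame (hθ m)
  have hemb := measurableEmbedding_frame (hθ m)
  have hI : Integrable (fun p : ℝ × ℝ => (P' \ P).indicator ρ (frame (θ m) p)) :=
    (hmp.integrable_comp_emb hemb).2 hind
  calc polyMass ρ θ (Function.update c m t') - polyMass ρ θ (Function.update c m t)
      = ∫ x in P' \ P, ρ x := (setIntegral_sdiff hPm hint.integrableOn hsub).symm
    _ = ∫ x, (P' \ P).indicator ρ x := (integral_indicator (hPm'.diff hPm)).symm
    _ = ∫ p : ℝ × ℝ, (P' \ P).indicator ρ (frame (θ m) p) := (hmp.integral_comp hemb _).symm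
    _ = ∫ σ, ∫ s, (P' \ P).indicator ρ (frame (θ m) (σ, s)) := integral_prod _ hI
    _ = ∫ σ, (Ioc t t').indicator (fun σ => lineMass ρ θ m (Function.update c m σ)) σ := by
        refine integral_congr_ae ?_
        have h1 : ∀ᵐ σ : ℝ, σ ≠ t := by simp [ae_iff]
        have h2 : ∀ᵐ σ : ℝ, σ ≠ t' := by simp [ae_iff]
        filter_upwards [h1, h2] with σ h1 h2
        by_cases hσ : σ ∈ Ioc t t'
        · rw [indicator_of_mem hσ, lineMass, hcut]
          refine integral_congr_ae (Eventually.of_forall fun s => ?_)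
          have h3 := hmem σ s hσ.1 (lt_of_le_of_ne hσ.2 h2)
          simp only [Function.update_self]
          by_cases h4 : frame (θ m) (σ, s) ∈ sideCut θ m c
          · rw [indicator_of_mem h4, indicator_of_mem (h3.2 h4)]
          · rw [indicator_of_notMem h4, indicator_of_notMem (fun h => h4 (h3.1 h))]
        · rw [indicator_of_notMem hσ]
          have h3 : σ < t ∨ t' < σ := by
            by_contra! h
            exact hσ ⟨lt_of_le_of_ne h.1 h1.symm, h.2⟩
          simp [hnot σ _ h3]
    _ = ∫ σ in t..t', lineMass ρ θ m (Function.update c m σ) := by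
        rw [integral_indicator measurableSet_Ioc, intervalIntegral.integral_of_le htt']

end Polygon

/-! ### First order expansion of the polygon mass, degenerate polygons included -/

section PolygonExpansion

variable {ι : Type*}

/-- Opposite bounding lines of the polygon leave room for an open strip between them. -/
def Wide (θ : ι → Plane) (c : ι → ℝ) : Prop := ∀ m m', θ m' = -θ m → -c m' < c m

open Classical in
/-- The mass of the `m`-th side of the polygon. -/
def sideMass (ρ : Plane → ℝ) (θ : ι → Plane) (m : ι) (c : ι → ℝ) : ℝ :=
  if Wide θ c then lineMass ρ θ m c else 0

lemma poly_eq_empty_of_not_wide {θ : ι → Plane} {c : ι → ℝ} (h : ¬ Wide θ c) : poly θ c = ∅ := by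
  rw [eq_empty_iff_forall_notMem]
  intro x hx
  refine h fun m m' hmm => ?_
  have h1 := hx m
  have h2 := hx m'
  rw [hmm, inner_neg_left] at h2
  linarith

lemma polyMass_eq_zero_of_not_wide (ρ : Plane → ℝ) {θ : ι → Plane} {c : ι → ℝ} (h : ¬ Wide θ c) :
    polyMass ρ θ c = 0 := by
  rw [polyMass, poly_eq_empty_of_not_wide h, setIntegral_empty]

variable [Fintype ι]

-- The offsets are raised one coordinate at a time. Every intermediate vector lies in the box
-- between `c` and `c'`, hence in the sup-norm ball on which line masses are within `ε` of their
-- values at `c₀`. Opposite sides of the lower polygon may coincide, since they only move apart.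
open Classical in
lemma polyMass_sub_of_le {ρ : Plane → ℝ} (hρ : Continuous ρ) (hs : HasCompactSupport ρ)
    {θ : ι → Plane} (hθ : ∀ m, ‖θ m‖ = 1) (hinj : Function.Injective θ) (c₀ : ι → ℝ)
    {ε δ : ℝ} (hδ : 0 < δ)
    (hG : ∀ c, dist c c₀ < δ → ∀ m, |lineMass ρ θ m c - lineMass ρ θ m c₀| ≤ ε)
    {c c' : ι → ℝ} (hcc' : c ≤ c') (hc : dist c c₀ < δ) (hc' : dist c' c₀ < δ)
    (hwide : ∀ m m', θ m' = -θ m → -c m' ≤ c m) :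
    |polyMass ρ θ c' - polyMass ρ θ c - ∑ m, lineMass ρ θ m c₀ * (c' m - c m)|
      ≤ ε * ∑ m, (c' m - c m) := by
  have hball : ∀ d : ι → ℝ, (∀ m, c m ≤ d m ∧ d m ≤ c' m) → dist d c₀ < δ := by
    intro d hd
    rw [dist_pi_lt_iff hδ] at hc hc' ⊢
    intro m
    have h1 := hc m
    have h2 := hc' m
    rw [Real.dist_eq, abs_lt] at h1 h2 ⊢
    constructor <;> linarith [hd m]
  have key : ∀ S : Finset ι,
      |polyMass ρ θ (S.piecewise c' c) - polyMass ρ θ c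
        - ∑ m ∈ S, lineMass ρ θ m c₀ * (c' m - c m)| ≤ ε * ∑ m ∈ S, (c' m - c m) := by
    intro S
    induction S using Finset.induction_on with
    | empty => simp
    | insert m S hm ih =>
      set d := S.piecewise c' c with hd
      have hdle : ∀ j, c j ≤ d j ∧ d j ≤ c' j := by
        intro j
        by_cases hj : j ∈ S
        · simp [hd, hj, hcc' j]
        · simp [hd, hj, hcc' j]
      have hdm : Function.update d m (c m) = d := by
        rw [Function.update_eq_self_iff]; simp [hd, hm]
      have hstep := polyMass_update_sub hρ hs hθ hinj m d (hcc' m)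
        (fun m' h => by linarith [hwide m m' h, (hdle m').1])
      rw [hdm] at hstep
      have hcont : Continuous fun σ => lineMass ρ θ m (Function.update d m σ) :=
        (continuous_lineMass hρ hs hθ m).comp (continuous_const.update m continuous_id)
      have hest : |(∫ σ in (c m)..(c' m), lineMass ρ θ m (Function.update d m σ))
          - lineMass ρ θ m c₀ * (c' m - c m)| ≤ ε * (c' m - c m) := by
        have h1 : (∫ σ in (c m)..(c' m), lineMass ρ θ m (Function.update d m σ))
            - lineMass ρ θ m c₀ * (c' m - c m)
            = ∫ σ in (c m)..(c' m), (lineMass ρ θ m (Function.update d m σ)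
              - lineMass ρ θ m c₀) := by
          rw [intervalIntegral.integral_sub (hcont.intervalIntegrable _ _)
            intervalIntegrable_const, intervalIntegral.integral_const, smul_eq_mul, mul_comm]
        rw [h1]
        have h2 := intervalIntegral.norm_integral_le_of_norm_le_const (a := c m) (b := c' m)
          (C := ε) (f := fun σ => lineMass ρ θ m (Function.update d m σ) - lineMass ρ θ m c₀) ?_
        · rwa [abs_of_nonneg (sub_nonneg.2 (hcc' m)), Real.norm_eq_abs] at h2
        · intro σ hσ
          rw [uIoc_of_le (hcc' m)] at hσ
          refine hG _ (hball _ fun j => ?_) m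
          by_cases hj : j = m
          · subst hj; simpa using ⟨hσ.1.le, hσ.2⟩
          · rw [Function.update_of_ne hj]; exact hdle j
      rw [Finset.piecewise_insert, Finset.sum_insert hm, Finset.sum_insert hm]
      rw [← hstep] at hest
      rw [abs_le] at ih hest ⊢
      constructor <;> linarith
  simpa using key Finset.univ

/-- First order expansion of the mass of a polygon at arbitrary, possibly degenerate, offsets, with
the side masses taken at the varying point. -/
theorem polyMass_sub_isLittleO {ρ : Plane → ℝ} (hρ : Continuous ρ) (hs : HasCompactSupport ρ)
    {θ : ι → Plane} (hθ : ∀ m, ‖θ m‖ = 1) (hinj : Function.Injective θ) (c₀ : ι → ℝ) :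
    (fun c => polyMass ρ θ c - polyMass ρ θ c₀ - ∑ m, sideMass ρ θ m c * (c m - c₀ m))
      =o[𝓝 c₀] (fun c => c - c₀) := by
  rw [Asymptotics.isLittleO_iff]
  intro ε hε
  set N : ℝ := ((Fintype.card ι : ℕ) : ℝ) with hN
  have hN0 : 0 ≤ N := Nat.cast_nonneg _
  -- Three errors of size `ε' * N * ‖c - c₀‖` have to fit; the `+ 1` covers `N = 0`.
  set ε' : ℝ := ε / (3 * N + 1) with hε'
  have hε'0 : 0 < ε' := by positivity
  have hε'N : 3 * (ε' * N) ≤ ε := by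
    have : ε' * (3 * N + 1) = ε := by rw [hε']; field_simp
    nlinarith
  have hev : ∀ᶠ c in 𝓝 c₀, ∀ m, |lineMass ρ θ m c - lineMass ρ θ m c₀| ≤ ε' := by
    rw [eventually_all]
    intro m
    have := Metric.tendsto_nhds.1 ((continuous_lineMass hρ hs hθ m).tendsto c₀) ε' hε'0
    filter_upwards [this] with c hc using hc.le
  obtain ⟨δ, hδ, hG⟩ := Metric.eventually_nhds_iff.1 hev
  have hnar : ∀ᶠ c in 𝓝 c₀, ∀ m m', c₀ m < -c₀ m' → c m < -c m' := by
    simp only [eventually_all]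
    intro m m' h
    exact (continuous_apply m).continuousAt.eventually_lt
      (continuous_apply m').neg.continuousAt h
  have hwid : ∀ᶠ c in 𝓝 c₀, ∀ m m', -c₀ m' < c₀ m → -c m' < c m := by
    simp only [eventually_all]
    intro m m' h
    exact (continuous_apply m').neg.continuousAt.eventually_lt
      (continuous_apply m).continuousAt h
  filter_upwards [Metric.ball_mem_nhds c₀ hδ, hnar, hwid] with c hc hnar hwid
  by_cases hW : Wide θ c
  -- Sides strictly crossed at `c₀` would still be crossed at `c`, so at `c₀` they at worst
  -- coincide.
  · have hcl₀ : ∀ m m', θ m' = -θ m → -c₀ m' ≤ c₀ m := by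
      intro m m' h
      by_contra! hlt
      exact lt_asymm (hnar m m' hlt) (hW m m' h)
    have hsup : dist (c ⊔ c₀) c₀ < δ := by
      rw [Metric.mem_ball, dist_pi_lt_iff hδ] at hc
      rw [dist_pi_lt_iff hδ]
      intro m
      refine lt_of_le_of_lt ?_ (hc m)
      rw [Real.dist_eq, Real.dist_eq, Pi.sup_apply]
      rcases le_total (c m) (c₀ m) with h | h
      · rw [sup_of_le_right h]; simp
      · rw [sup_of_le_left h]
    have hnorm : ∀ m, |c m - c₀ m| ≤ ‖c - c₀‖ := fun m => norm_le_pi_norm (c - c₀) m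
    -- Both `c₀` and `c` lie below `c ⊔ c₀`, so each comparison is purely outward; subtracting the
    -- two leaves the change from `c₀` to `c`.
    have e1 := polyMass_sub_of_le hρ hs hθ hinj c₀ hδ (fun c hc => hG hc)
      (le_sup_right : c₀ ≤ c ⊔ c₀) (by simpa using hδ) hsup hcl₀
    have e2 := polyMass_sub_of_le hρ hs hθ hinj c₀ hδ (fun c hc => hG hc)
      (le_sup_left : c ≤ c ⊔ c₀) hc hsup (fun m m' h => (hW m m' h).le)
    have s1 : ∑ m, ((c ⊔ c₀) m - c₀ m) ≤ N * ‖c - c₀‖ := by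
      have : ∑ m, ((c ⊔ c₀) m - c₀ m) ≤ ∑ _m : ι, ‖c - c₀‖ := by
        refine Finset.sum_le_sum fun m _ => ?_
        refine le_trans ?_ (hnorm m)
        rw [Pi.sup_apply]
        rcases le_total (c m) (c₀ m) with h | h
        · rw [sup_of_le_right h]; simp
        · rw [sup_of_le_left h]; exact le_abs_self _
      simpa [hN] using this
    have s2 : ∑ m, ((c ⊔ c₀) m - c m) ≤ N * ‖c - c₀‖ := by
      have : ∑ m, ((c ⊔ c₀) m - c m) ≤ ∑ _m : ι, ‖c - c₀‖ := by
        refine Finset.sum_le_sum fun m _ => ?_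
        refine le_trans ?_ (hnorm m)
        rw [Pi.sup_apply]
        rcases le_total (c m) (c₀ m) with h | h
        · rw [sup_of_le_right h, abs_sub_comm]; exact le_abs_self _
        · rw [sup_of_le_left h]; simp
      simpa [hN] using this
    have s3 : |∑ m, (lineMass ρ θ m c - lineMass ρ θ m c₀) * (c m - c₀ m)|
        ≤ ε' * N * ‖c - c₀‖ := by
      have : |∑ m, (lineMass ρ θ m c - lineMass ρ θ m c₀) * (c m - c₀ m)|
          ≤ ∑ _m : ι, ε' * ‖c - c₀‖ := by
        refine (Finset.abs_sum_le_sum_abs _ _).trans (Finset.sum_le_sum fun m _ => ?_)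
        rw [abs_mul]
        exact mul_le_mul (hG hc m) (hnorm m) (abs_nonneg _) hε'0.le
      calc _ ≤ _ := this
        _ = _ := by simp [hN]; ring
    have s1' := mul_le_mul_of_nonneg_left s1 hε'0.le
    have s2' := mul_le_mul_of_nonneg_left s2 hε'0.le
    have hsm : ∀ m, sideMass ρ θ m c = lineMass ρ θ m c := fun m => if_pos hW
    simp only [hsm]
    have hfin : 3 * (ε' * N) * ‖c - c₀‖ ≤ ε * ‖c - c₀‖ :=
      mul_le_mul_of_nonneg_right hε'N (norm_nonneg _)
    have hid : polyMass ρ θ c - polyMass ρ θ c₀ - ∑ m, lineMass ρ θ m c * (c m - c₀ m)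
        = (polyMass ρ θ (c ⊔ c₀) - polyMass ρ θ c₀
            - ∑ m, lineMass ρ θ m c₀ * ((c ⊔ c₀) m - c₀ m))
          - (polyMass ρ θ (c ⊔ c₀) - polyMass ρ θ c
            - ∑ m, lineMass ρ θ m c₀ * ((c ⊔ c₀) m - c m))
          - ∑ m, (lineMass ρ θ m c - lineMass ρ θ m c₀) * (c m - c₀ m) := by
      have : ∑ m, lineMass ρ θ m c * (c m - c₀ m)
          = ∑ m, lineMass ρ θ m c₀ * ((c ⊔ c₀) m - c₀ m)
            - ∑ m, lineMass ρ θ m c₀ * ((c ⊔ c₀) m - c m)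
            + ∑ m, (lineMass ρ θ m c - lineMass ρ θ m c₀) * (c m - c₀ m) := by
        rw [← Finset.sum_sub_distrib, ← Finset.sum_add_distrib]
        exact Finset.sum_congr rfl fun m _ => by ring
      rw [this]; ring
    rw [hid, Real.norm_eq_abs]
    rw [abs_le] at e1 e2 s3 ⊢
    constructor <;> linarith
  -- `Wide` is an open condition, so it fails at `c₀` as well: both masses and all side masses at
  -- `c` are zero.
  · have hW₀ : ¬ Wide θ c₀ := fun h => hW fun m m' hmm => hwid m m' (h m m' hmm)
    simp only [sideMass, if_neg hW, polyMass_eq_zero_of_not_wide ρ hW,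
      polyMass_eq_zero_of_not_wide ρ hW₀]
    simp only [zero_mul, Finset.sum_const_zero, sub_zero, norm_zero]
    positivity

end PolygonExpansion

/-! ### Grouping constraints by direction -/

section Grouping

/-- The unit vector in the direction of `v`. -/
def unitDir (v : Plane) : Plane := ‖v‖⁻¹ • v

lemma norm_unitDir {v : Plane} (hv : v ≠ 0) : ‖unitDir v‖ = 1 := by
  rw [unitDir, norm_smul, norm_inv, norm_norm, inv_mul_cancel₀ (norm_ne_zero_iff.2 hv)]

lemma norm_smul_unitDir (v : Plane) : ‖v‖ • unitDir v = v := by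
  by_cases hv : v = 0
  · simp [hv]
  · rw [unitDir, smul_smul, mul_inv_cancel₀ (norm_ne_zero_iff.2 hv), one_smul]

lemma inner_eq_norm_mul_inner_unitDir (v x : Plane) :
    inner ℝ v x = ‖v‖ * inner ℝ (unitDir v) x := by
  conv_lhs => rw [← norm_smul_unitDir v]
  rw [real_inner_smul_left]

variable {κ : Type*} [Fintype κ]

open Classical in
/-- The set of directions of a finite family of vectors. -/
def dirs (b : κ → Plane) : Finset Plane := Finset.univ.image fun k => unitDir (b k)

/-- The direction of the `k`-th vector. -/
def dirOf (b : κ → Plane) (k : κ) : dirs b :=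
  ⟨unitDir (b k), by classical exact Finset.mem_image_of_mem _ (Finset.mem_univ k)⟩

open Classical in
/-- The vectors with a given direction. -/
def dirClass (b : κ → Plane) (d : dirs b) : Finset κ := Finset.univ.filter fun k => dirOf b k = d

lemma mem_dirClass {b : κ → Plane} {d : dirs b} {k : κ} : k ∈ dirClass b d ↔ dirOf b k = d := by
  simp [dirClass]

lemma dirClass_nonempty (b : κ → Plane) (d : dirs b) : (dirClass b d).Nonempty := by
  classical
  obtain ⟨k, -, hk⟩ := Finset.mem_image.1 d.2
  exact ⟨k, mem_dirClass.2 (Subtype.ext hk)⟩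

/-- The smallest normalized offset among the constraints with a given direction. -/
def dirOffset (b : κ → Plane) (C : κ → ℝ) (d : dirs b) : ℝ :=
  (dirClass b d).inf' (dirClass_nonempty b d) fun k => C k / ‖b k‖

/-- The `k`-th constraint is a sharpest one among those with the same direction. -/
def Active (b : κ → Plane) (C : κ → ℝ) (k : κ) : Prop := C k / ‖b k‖ = dirOffset b C (dirOf b k)

lemma dirOffset_le (b : κ → Plane) (C : κ → ℝ) (k : κ) :
    dirOffset b C (dirOf b k) ≤ C k / ‖b k‖ :=
  Finset.inf'_le _ (mem_dirClass.2 rfl)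

lemma exists_active (b : κ → Plane) (C : κ → ℝ) (d : dirs b) :
    ∃ k, dirOf b k = d ∧ Active b C k := by
  obtain ⟨k, hk, h⟩ := Finset.exists_mem_eq_inf' (dirClass_nonempty b d) fun k => C k / ‖b k‖
  rw [mem_dirClass] at hk
  refine ⟨k, hk, ?_⟩
  rw [Active, hk]
  exact h.symm

lemma poly_dirOffset {b : κ → Plane} (hb : ∀ k, b k ≠ 0) (C : κ → ℝ) :
    poly (Subtype.val : dirs b → Plane) (dirOffset b C) = {x | ∀ k, inner ℝ (b k) x < C k} := by
  ext x
  constructor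
  · intro hx k
    have h1 := (hx (dirOf b k)).trans_le (dirOffset_le b C k)
    rw [lt_div_iff₀ (norm_pos_iff.2 (hb k))] at h1
    rw [inner_eq_norm_mul_inner_unitDir, mul_comm]
    exact h1
  · intro hx d
    obtain ⟨k, hk, hact⟩ := exists_active b C d
    have h1 := hx k
    rw [inner_eq_norm_mul_inner_unitDir, mul_comm, ← lt_div_iff₀ (norm_pos_iff.2 (hb k))] at h1
    rw [← hk, ← hact]
    exact h1

lemma continuous_dirOffset (b : κ → Plane) : Continuous (dirOffset b) := by
  refine continuous_pi fun d => ?_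
  exact Continuous.finset_inf'_apply (f := fun k (C : κ → ℝ) => C k / ‖b k‖) _
    fun k _ => (continuous_apply k).div_const _

/-- Strict slack in a direction class survives small changes, so new minimizers are among the old
ones. This replaces differentiability of the minimum: a constraint active at the moving point
measures the exact displacement of its line. -/
lemma eventually_active (b : κ → Plane) (C₀ : κ → ℝ) :
    ∀ᶠ C in 𝓝 C₀, ∀ k, Active b C k → Active b C₀ k := by
  rw [eventually_all]
  intro k
  by_cases h : Active b C₀ k
  · exact Eventually.of_forall fun _ _ => h
  · have hlt : dirOffset b C₀ (dirOf b k) < C₀ k / ‖b k‖ :=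
      lt_of_le_of_ne (dirOffset_le b C₀ k) (Ne.symm h)
    have h1 : Continuous fun C : κ → ℝ => dirOffset b C (dirOf b k) :=
      continuous_pi_iff.1 (continuous_dirOffset b) _
    have h2 : Continuous fun C : κ → ℝ => C k / ‖b k‖ := (continuous_apply k).div_const _
    filter_upwards [h1.continuousAt.eventually_lt h2.continuousAt hlt] with C hC hact
    exact absurd hact hC.ne'

lemma sub_eq_of_active {b : κ → Plane} (hb : ∀ k, b k ≠ 0) {C C₀ : κ → ℝ} {k : κ}
    (h : Active b C k) (h₀ : Active b C₀ k) :
    C k - C₀ k = ‖b k‖ * (dirOffset b C (dirOf b k) - dirOffset b C₀ (dirOf b k)) := by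
  rw [← h, ← h₀]
  have := norm_ne_zero_iff.2 (hb k)
  field_simp

lemma dirOffset_sub_isBigO {b : κ → Plane} (hb : ∀ k, b k ≠ 0) (C₀ : κ → ℝ) :
    (fun C => dirOffset b C - dirOffset b C₀) =O[𝓝 C₀] (fun C => C - C₀) := by
  rw [Asymptotics.isBigO_pi]
  intro d
  -- The factor for whichever `k` is active is one summand, so the sum serves every case.
  refine Asymptotics.IsBigO.of_bound (∑ k, ‖b k‖⁻¹) ?_
  filter_upwards [eventually_active b C₀] with C hC
  obtain ⟨k, rfl, hact⟩ := exists_active b C d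
  have h1 := sub_eq_of_active hb hact (hC k hact)
  have hpos := norm_pos_iff.2 (hb k)
  have h2 : (dirOffset b C - dirOffset b C₀) (dirOf b k) = ‖b k‖⁻¹ * (C k - C₀ k) := by
    rw [h1, ← mul_assoc, inv_mul_cancel₀ hpos.ne', one_mul]; rfl
  rw [h2, norm_mul, norm_inv, norm_norm]
  refine mul_le_mul ?_ (norm_le_pi_norm (C - C₀) k) (norm_nonneg _)
    (Finset.sum_nonneg fun _ _ => by positivity)
  exact Finset.single_le_sum (f := fun k => ‖b k‖⁻¹) (fun _ _ => by positivity)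
    (Finset.mem_univ k)

/-- First order expansion of the mass of a polygon given by constraints that may share
directions. -/
theorem setIntegral_constraints_sub_isLittleO {ρ : Plane → ℝ} (hρ : Continuous ρ)
    (hs : HasCompactSupport ρ) {b : κ → Plane} (hb : ∀ k, b k ≠ 0) (C₀ : κ → ℝ) :
    (fun C : κ → ℝ => (∫ x in {x | ∀ k, inner ℝ (b k) x < C k}, ρ x)
        - (∫ x in {x | ∀ k, inner ℝ (b k) x < C₀ k}, ρ x)
        - ∑ d, sideMass ρ (Subtype.val : dirs b → Plane) d (dirOffset b C)
          * (dirOffset b C d - dirOffset b C₀ d))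
      =o[𝓝 C₀] (fun C => C - C₀) := by
  have hθ : ∀ d : dirs b, ‖(d : Plane)‖ = 1 := by
    intro d
    obtain ⟨k, hk⟩ := dirClass_nonempty b d
    rw [← mem_dirClass.1 hk]
    exact norm_unitDir (hb k)
  have h1 := polyMass_sub_isLittleO hρ hs hθ Subtype.val_injective (dirOffset b C₀)
  have h2 := (h1.comp_tendsto ((continuous_dirOffset b).tendsto C₀)).trans_isBigO
    (dirOffset_sub_isBigO hb C₀)
  simp only [← poly_dirOffset hb]
  exact h2

end Grouping

/-! ### Regions and their edges -/

/-- At an interior point a small step along a nonzero normal is still allowed, so that constraint is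
strict. Constraints with zero normal do not depend on the point and hold because the polygon is
nonempty. -/
lemma interior_polygon {m : ℕ} (ν : Fin m → Plane) (ζ : Fin m → ℝ)
    (hne : {x : Plane | ∀ l, inner ℝ (ν l) x ≤ ζ l}.Nonempty) :
    interior {x : Plane | ∀ l, inner ℝ (ν l) x ≤ ζ l}
      = {x | ∀ l, ν l ≠ 0 → inner ℝ (ν l) x < ζ l} := by
  apply Subset.antisymm
  · intro x hx l hl
    have hcont : Tendsto (fun ε : ℝ => x + ε • ν l) (𝓝[>] 0) (𝓝 x) := by
      have h : Continuous fun ε : ℝ => x + ε • ν l := by fun_prop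
      have := h.tendsto 0
      simp only [zero_smul, add_zero] at this
      exact this.mono_left nhdsWithin_le_nhds
    obtain ⟨ε, hε, hε0⟩ :=
      ((hcont.eventually (mem_interior_iff_mem_nhds.1 hx)).and self_mem_nhdsWithin).exists
    have h1 := hε l
    rw [inner_add_right, inner_smul_right, real_inner_self_eq_norm_sq] at h1
    have h2 : 0 < ε * ‖ν l‖ ^ 2 := mul_pos hε0 (pow_pos (norm_pos_iff.2 hl) 2)
    linarith
  · apply interior_maximal
    · intro x hx l
      by_cases hl : ν l = 0
      · obtain ⟨y, hy⟩ := hne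
        have := hy l
        simpa [hl] using this
      · exact (hx l hl).le
    · simp only [ofPred_forall]
      exact isOpen_iInter_of_finite fun l => isOpen_iInter_of_finite fun _ =>
        isOpen_lt (continuous_const.inner continuous_id) continuous_const

section Region

variable {n : ℕ} {D : Set Plane} {a : Fin n → Plane} {ξ : EuclideanSpace ℝ (Fin n)}

lemma isOpen_region (i : Fin n) : IsOpen (region D a ξ i) := by
  have : region D a ξ i = interior D ∩
      ⋂ j, ⋂ _ : j ≠ i, {x | inner ℝ (a j) x - ξ j < inner ℝ (a i) x - ξ i} := by
    ext x; simp [region]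
  rw [this]
  refine isOpen_interior.inter (isOpen_iInter_of_finite fun j =>
    isOpen_iInter_of_finite fun _ => ?_)
  exact isOpen_lt (by fun_prop) (by fun_prop)

lemma region_subset (i : Fin n) : region D a ξ i ⊆ D := fun _ hx => interior_subset hx.1

lemma closure_region_subset (hD : IsClosed D) (i : Fin n) : closure (region D a ξ i) ⊆ D :=
  closure_minimal (region_subset i) hD

lemma isClosed_edge (i j : Fin n) : IsClosed (edge D a ξ i j) :=
  isClosed_closure.inter isClosed_closure

lemma edge_comm (i j : Fin n) : edge D a ξ i j = edge D a ξ j i := inter_comm _ _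

lemma edgeWeight_comm (ϱ : Plane → ℝ) (i j : Fin n) :
    edgeWeight D a ϱ ξ i j = edgeWeight D a ϱ ξ j i := by
  rw [edgeWeight, edgeWeight, edge_comm, norm_sub_rev]

lemma edge_subset (hD : IsClosed D) (i j : Fin n) : edge D a ξ i j ⊆ D :=
  inter_subset_left.trans (closure_region_subset hD i)

lemma edgeWeight_congr (hD : IsClosed D) {ϱ ρ : Plane → ℝ} (h : EqOn ϱ ρ D) (i j : Fin n) :
    edgeWeight D a ϱ ξ i j = edgeWeight D a ρ ξ i j := by
  rw [edgeWeight, edgeWeight, setIntegral_congr_fun (isClosed_edge i j).measurableSet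
    (h.mono (edge_subset hD i j))]

lemma edgeWeight_eq_zero_of_edge_eq_empty (ϱ : Plane → ℝ) {i j : Fin n} (h : edge D a ξ i j = ∅) :
    edgeWeight D a ϱ ξ i j = 0 := by
  rw [edgeWeight, h, setIntegral_empty, mul_zero]

lemma inner_le_of_mem_closure_region {i j : Fin n} (hij : j ≠ i) {x : Plane}
    (hx : x ∈ closure (region D a ξ i)) : inner ℝ (a j - a i) x ≤ ξ j - ξ i := by
  have hcl : IsClosed {x : Plane | inner ℝ (a j - a i) x ≤ ξ j - ξ i} :=
    isClosed_le (by fun_prop) continuous_const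
  refine closure_minimal (fun y hy => ?_) hcl hx
  have := hy.2 j hij
  show inner ℝ (a j - a i) y ≤ ξ j - ξ i
  rw [inner_sub_left]
  linarith

lemma inner_eq_of_mem_edge {i j : Fin n} (hij : j ≠ i) {x : Plane} (hx : x ∈ edge D a ξ i j) :
    inner ℝ (a j - a i) x = ξ j - ξ i := by
  have h1 := inner_le_of_mem_closure_region hij hx.1
  have h2 := inner_le_of_mem_closure_region hij.symm hx.2
  rw [inner_sub_left] at h1 h2 ⊢
  linarith

lemma edge_subset_line (ha : Function.Injective a) {i j : Fin n} (hij : j ≠ i) :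
    edge D a ξ i j ⊆ {x | inner ℝ (unitDir (a j - a i)) x = (ξ j - ξ i) / ‖a j - a i‖} := by
  intro x hx
  have h0 : ‖a j - a i‖ ≠ 0 := norm_ne_zero_iff.2 (sub_ne_zero.2 (ha.ne hij))
  have h1 := inner_eq_of_mem_edge hij hx
  rw [inner_eq_norm_mul_inner_unitDir] at h1
  show _ = _
  rw [← h1]
  field_simp

lemma edgeWeight_nonneg (hD : IsClosed D) {ϱ : Plane → ℝ} (hϱ : ∀ x ∈ D, 0 ≤ ϱ x) (i j : Fin n) :
    0 ≤ edgeWeight D a ϱ ξ i j := by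
  refine mul_nonneg (by positivity) ?_
  exact setIntegral_nonneg (isClosed_edge i j).measurableSet fun x hx =>
    hϱ x (edge_subset hD i j hx)

/-- Edge weights as integrals over the real line. -/
lemma edgeWeight_eq_integral (ha : Function.Injective a) (ρ : Plane → ℝ) {i j : Fin n}
    (hij : j ≠ i) :
    edgeWeight D a ρ ξ i j = (1 / ‖a j - a i‖) *
      ∫ s, (edge D a ξ i j).indicator ρ
        (frame (unitDir (a j - a i)) ((ξ j - ξ i) / ‖a j - a i‖, s)) := by
  have hu := norm_unitDir (sub_ne_zero.2 (ha.ne hij))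
  rw [edgeWeight, setIntegral_hausdorff_line hu _ ρ _ (edge_subset_line ha hij),
    ← integral_indicator]
  · rfl
  · exact (isClosed_edge i j).measurableSet.preimage
      (isometry_frame_line hu _).continuous.measurable

/-- On every line the density is dominated by the same constant on `[-R, R]`. That the bound is
independent of `ξ` makes the cocoercivity constant of `Theta` uniform. -/
lemma exists_edgeWeight_le (ha : Function.Injective a) {ρ : Plane → ℝ} (hρ : Continuous ρ)
    (hs : HasCompactSupport ρ) :
    ∃ B : ℝ, 0 ≤ B ∧ ∀ (ξ : EuclideanSpace ℝ (Fin n)) (i j : Fin n), j ≠ i →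
      edgeWeight D a ρ ξ i j ≤ B := by
  obtain ⟨M, R, hM0, hR0, hM, hR⟩ := exists_bound_of_hasCompactSupport hρ hs
  set K := ∫ s, (Icc (-R) R).indicator (fun _ => M) s
  have hK : 0 ≤ K := integral_nonneg fun s => indicator_nonneg (fun _ _ => hM0) s
  refine ⟨∑ i, ∑ j, (1 / ‖a j - a i‖) * K,
    Finset.sum_nonneg fun i _ => Finset.sum_nonneg fun j _ => by positivity,
    fun ξ i j hij => ?_⟩
  have hu := norm_unitDir (sub_ne_zero.2 (ha.ne hij))
  have h1 : edgeWeight D a ρ ξ i j ≤ (1 / ‖a j - a i‖) * K := by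
    rw [edgeWeight_eq_integral ha ρ hij]
    refine mul_le_mul_of_nonneg_left ?_ (by positivity)
    refine (le_abs_self _).trans ?_
    rw [← Real.norm_eq_abs]
    refine norm_integral_le_of_norm_le (integrable_bound M R) (Eventually.of_forall fun s => ?_)
    exact abs_indicator_frame_le hM0 hM hR hu _ _ _
  refine h1.trans ?_
  refine le_trans ?_ (Finset.single_le_sum
    (f := fun i => ∑ j, (1 / ‖a j - a i‖) * K)
    (fun i _ => Finset.sum_nonneg fun j _ => by positivity) (Finset.mem_univ i))
  exact Finset.single_le_sum (f := fun j => (1 / ‖a j - a i‖) * K)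
    (fun j _ => by positivity) (Finset.mem_univ j)

end Region

/-! ### The constraints that define a region -/

section Constraints

variable {n m : ℕ}

/-- The indices of the constraints that define the `i`-th region: the competitors of `i` and the
nontrivial sides of the polygon. -/
abbrev ConIndex (ν : Fin m → Plane) (i : Fin n) : Type :=
  {j : Fin n // j ≠ i} ⊕ {l : Fin m // ν l ≠ 0}

/-- The normal vectors of the constraints that define the `i`-th region. -/
def conNormal (a : Fin n → Plane) (ν : Fin m → Plane) (i : Fin n) : ConIndex ν i → Plane :=
  Sum.elim (fun j => a j - a i) (fun l => ν l)

/-- The offsets of the constraints that define the `i`-th region. -/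
def conOffset (ν : Fin m → Plane) (ζ : Fin m → ℝ) (i : Fin n) (ξ : EuclideanSpace ℝ (Fin n)) :
    ConIndex ν i → ℝ :=
  Sum.elim (fun j => ξ j - ξ i) (fun l => ζ l)

variable {a : Fin n → Plane} {ν : Fin m → Plane} {ζ : Fin m → ℝ} {D : Set Plane}

lemma conNormal_ne_zero (ha : Function.Injective a) (i : Fin n) (k : ConIndex ν i) :
    conNormal a ν i k ≠ 0 := by
  rcases k with j | l
  · exact sub_ne_zero.2 (ha.ne j.2)
  · exact l.2

lemma continuous_conOffset (i : Fin n) : Continuous (conOffset ν ζ i) := by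
  refine continuous_pi fun k => ?_
  rcases k with j | l
  · show Continuous fun ξ : EuclideanSpace ℝ (Fin n) => ξ j - ξ i
    fun_prop
  · exact continuous_const

lemma conOffset_sub_isBigO (i : Fin n) (ξ₀ : EuclideanSpace ℝ (Fin n)) :
    (fun ξ => conOffset ν ζ i ξ - conOffset ν ζ i ξ₀) =O[𝓝 ξ₀] (fun ξ => ξ - ξ₀) := by
  refine Asymptotics.IsBigO.of_bound 2 (Eventually.of_forall fun ξ => ?_)
  rw [pi_norm_le_iff_of_nonneg (by positivity)]
  rintro (j | l)
  · show ‖(ξ j - ξ i) - (ξ₀ j - ξ₀ i)‖ ≤ _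
    have h1 : ‖(ξ - ξ₀) j‖ ≤ ‖ξ - ξ₀‖ := PiLp.norm_apply_le _ _
    have h2 : ‖(ξ - ξ₀) i‖ ≤ ‖ξ - ξ₀‖ := PiLp.norm_apply_le _ _
    rw [PiLp.sub_apply] at h1 h2
    calc ‖(ξ j - ξ i) - (ξ₀ j - ξ₀ i)‖ = ‖(ξ j - ξ₀ j) - (ξ i - ξ₀ i)‖ := by congr 1; ring
      _ ≤ ‖ξ j - ξ₀ j‖ + ‖ξ i - ξ₀ i‖ := norm_sub_le _ _
      _ ≤ 2 * ‖ξ - ξ₀‖ := by linarith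
  · show ‖ζ l - ζ l‖ ≤ _
    rw [sub_self, norm_zero]; positivity

lemma region_eq_constraints
    (hint : interior D = {x | ∀ l, ν l ≠ 0 → inner ℝ (ν l) x < ζ l})
    (i : Fin n) (ξ : EuclideanSpace ℝ (Fin n)) :
    region D a ξ i = {x | ∀ k, inner ℝ (conNormal a ν i k) x < conOffset ν ζ i ξ k} := by
  ext x
  constructor
  · rintro ⟨h1, h2⟩ (j | l)
    · have := h2 j j.2
      show inner ℝ (a j - a i) x < ξ j - ξ i
      rw [inner_sub_left]; linarith
    · rw [hint] at h1
      exact h1 l l.2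
  · intro hx
    refine ⟨?_, fun j hj => ?_⟩
    · rw [hint]
      exact fun l hl => hx (Sum.inr ⟨l, hl⟩)
    · have : inner ℝ (a j - a i) x < ξ j - ξ i := hx (Sum.inl ⟨j, hj⟩)
      rw [inner_sub_left] at this; linarith

lemma inner_le_of_mem_closure
    (hint : interior D = {x | ∀ l, ν l ≠ 0 → inner ℝ (ν l) x < ζ l})
    (i : Fin n) {ξ : EuclideanSpace ℝ (Fin n)} {x : Plane}
    (hx : x ∈ closure (region D a ξ i)) (k : ConIndex ν i) :
    inner ℝ (conNormal a ν i k) x ≤ conOffset ν ζ i ξ k := by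
  have hcl : IsClosed {x : Plane | inner ℝ (conNormal a ν i k) x ≤ conOffset ν ζ i ξ k} :=
    isClosed_le (by fun_prop) continuous_const
  refine closure_minimal (fun y hy => ?_) hcl hx
  rw [region_eq_constraints hint] at hy
  exact (hy k).le

end Constraints

/-! ### Matching edges of regions with sides of the constraint polygon -/

section EdgeConstraints

variable {n m : ℕ} {a : Fin n → Plane} {ν : Fin m → Plane} {ζ : Fin m → ℝ} {D : Set Plane}

lemma conOffset_eq_of_active (ha : Function.Injective a) {i : Fin n}
    {ξ : EuclideanSpace ℝ (Fin n)} {k : ConIndex ν i}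
    (h : Active (conNormal a ν i) (conOffset ν ζ i ξ) k) :
    conOffset ν ζ i ξ k = ‖conNormal a ν i k‖
      * dirOffset (conNormal a ν i) (conOffset ν ζ i ξ) (dirOf (conNormal a ν i) k) := by
  rw [← h, mul_div_cancel₀]
  exact norm_ne_zero_iff.2 (conNormal_ne_zero ha i k)

/-- A point of the edge lies on the bounding line of `j` and weakly satisfies every constraint of
`i`, so none in the same direction is sharper. Contrapositively, inactive competitors carry no edge
weight. -/
lemma active_of_edge_nonempty (ha : Function.Injective a)
    (hint : interior D = {x | ∀ l, ν l ≠ 0 → inner ℝ (ν l) x < ζ l})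
    {i : Fin n} {ξ : EuclideanSpace ℝ (Fin n)} (j : {j : Fin n // j ≠ i})
    (h : (edge D a ξ i j).Nonempty) :
    Active (conNormal a ν i) (conOffset ν ζ i ξ) (Sum.inl j) := by
  obtain ⟨x, hx⟩ := h
  refine le_antisymm ?_ (dirOffset_le _ _ _)
  refine Finset.le_inf' _ _ fun k hk => ?_
  have hdir : unitDir (conNormal a ν i k) = unitDir (a j - a i) :=
    congrArg Subtype.val (mem_dirClass.1 hk)
  have h1 : inner ℝ (unitDir (a j - a i)) x = (ξ j - ξ i) / ‖a j - a i‖ :=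
    edge_subset_line ha j.2 hx
  have h2 := inner_le_of_mem_closure hint i hx.1 k
  rw [inner_eq_norm_mul_inner_unitDir, hdir, h1, mul_comm,
    ← le_div_iff₀ (norm_pos_iff.2 (conNormal_ne_zero ha i k))] at h2
  exact h2

/-- Among competitors whose bounding lines coincide, only the farthest one has a nonempty region. -/
lemma region_eq_empty_of_active (ha : Function.Injective a)
    {i : Fin n} {ξ : EuclideanSpace ℝ (Fin n)} (j j' : {j : Fin n // j ≠ i})
    (hj : Active (conNormal a ν i) (conOffset ν ζ i ξ) (Sum.inl j))
    (hj' : Active (conNormal a ν i) (conOffset ν ζ i ξ) (Sum.inl j'))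
    (hdir : dirOf (conNormal a ν i) (Sum.inl j) = dirOf (conNormal a ν i) (Sum.inl j'))
    (hlt : ‖a j - a i‖ < ‖a j' - a i‖) : region D a ξ j = ∅ := by
  rw [eq_empty_iff_forall_notMem]
  intro x hx
  have e1 := conOffset_eq_of_active ha hj
  have e2 := conOffset_eq_of_active ha hj'
  rw [← hdir] at e2
  set o := dirOffset (conNormal a ν i) (conOffset ν ζ i ξ) (dirOf (conNormal a ν i) (Sum.inl j))
  have hu : unitDir (a j' - a i) = unitDir (a j - a i) := (congrArg Subtype.val hdir).symm
  change ξ j - ξ i = ‖a j - a i‖ * o at e1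
  change ξ j' - ξ i = ‖a j' - a i‖ * o at e2
  have i1 := inner_eq_norm_mul_inner_unitDir (a j - a i) x
  have i2 := inner_eq_norm_mul_inner_unitDir (a j' - a i) x
  rw [hu] at i2
  rw [inner_sub_left] at i1 i2
  have hpos : 0 < ‖a j - a i‖ := norm_pos_iff.2 (sub_ne_zero.2 (ha.ne j.2))
  have hne : (j' : Fin n) ≠ j := by
    intro h
    rw [h] at hlt
    exact lt_irrefl _ hlt
  have h1 := hx.2 i j.2.symm
  have h2 := hx.2 j' hne
  -- Where `j` beats `i`, the point is beyond the common line, and there the farther competitor `j'`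
  -- beats `j`.
  have h3 : o < inner ℝ (unitDir (a j - a i)) x := by
    by_contra! hle
    have := mul_le_mul_of_nonneg_left hle hpos.le
    linarith
  have h4 := mul_lt_mul_of_pos_left h3 (sub_pos.2 hlt)
  linarith

/-- A constraint is strict at a point of a bounding line that satisfies all transversal constraints,
unless it defines the same bounding line. -/
lemma inner_lt_of_mem_sideCut (ha : Function.Injective a)
    {i : Fin n} {ξ : EuclideanSpace ℝ (Fin n)} {d : dirs (conNormal a ν i)}
    (hW : Wide (Subtype.val : dirs (conNormal a ν i) → Plane)
      (dirOffset (conNormal a ν i) (conOffset ν ζ i ξ))) {x : Plane}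
    (hline : inner ℝ (d : Plane) x = dirOffset (conNormal a ν i) (conOffset ν ζ i ξ) d)
    (hx : x ∈ sideCut (Subtype.val : dirs (conNormal a ν i) → Plane) d
      (dirOffset (conNormal a ν i) (conOffset ν ζ i ξ))) (k : ConIndex ν i)
    (hk : dirOf (conNormal a ν i) k = d →
      ¬ Active (conNormal a ν i) (conOffset ν ζ i ξ) k) :
    inner ℝ (conNormal a ν i k) x < conOffset ν ζ i ξ k := by
  set C := conOffset ν ζ i ξ
  have hpos : 0 < ‖conNormal a ν i k‖ := norm_pos_iff.2 (conNormal_ne_zero ha i k)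
  rw [inner_eq_norm_mul_inner_unitDir, mul_comm, ← lt_div_iff₀ hpos]
  change inner ℝ ((dirOf (conNormal a ν i) k : dirs (conNormal a ν i)) : Plane) x < _
  by_cases h1 : dirOf (conNormal a ν i) k = d
  · have h2 := lt_of_le_of_ne (dirOffset_le (conNormal a ν i) C k) (Ne.symm (hk h1))
    rw [h1] at h2 ⊢
    rwa [hline]
  · refine lt_of_lt_of_le ?_ (dirOffset_le (conNormal a ν i) C k)
    by_cases h2 : ((dirOf (conNormal a ν i) k : dirs (conNormal a ν i)) : Plane) = -(d : Plane)
    · have := hW d (dirOf (conNormal a ν i) k) h2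
      rw [h2, inner_neg_left, hline]
      linarith
    · exact hx (dirOf (conNormal a ν i) k) (fun h => h1 (Subtype.ext h)) h2

/-- The edge shared with the farthest competitor defining a bounding line. -/
lemma mem_edge_of_mem_sideCut (ha : Function.Injective a)
    (hint : interior D = {x | ∀ l, ν l ≠ 0 → inner ℝ (ν l) x < ζ l})
    {i : Fin n} {ξ : EuclideanSpace ℝ (Fin n)} {d : dirs (conNormal a ν i)}
    (hW : Wide (Subtype.val : dirs (conNormal a ν i) → Plane)
      (dirOffset (conNormal a ν i) (conOffset ν ζ i ξ)))
    (hpol : ∀ l, dirOf (conNormal a ν i) (Sum.inr l) = d →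
      ¬ Active (conNormal a ν i) (conOffset ν ζ i ξ) (Sum.inr l))
    (j : {j : Fin n // j ≠ i}) (hjd : dirOf (conNormal a ν i) (Sum.inl j) = d)
    (hj : Active (conNormal a ν i) (conOffset ν ζ i ξ) (Sum.inl j))
    (hmax : ∀ j', dirOf (conNormal a ν i) (Sum.inl j') = d →
      Active (conNormal a ν i) (conOffset ν ζ i ξ) (Sum.inl j') →
      ‖a j' - a i‖ ≤ ‖a j - a i‖) {x : Plane}
    (hline : inner ℝ (d : Plane) x = dirOffset (conNormal a ν i) (conOffset ν ζ i ξ) d)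
    (hx : x ∈ sideCut (Subtype.val : dirs (conNormal a ν i) → Plane) d
      (dirOffset (conNormal a ν i) (conOffset ν ζ i ξ))) :
    x ∈ edge D a ξ i j := by
  set C := conOffset ν ζ i ξ with hC
  have hd1 : ‖(d : Plane)‖ = 1 := by
    rw [← hjd]; exact norm_unitDir (conNormal_ne_zero ha i (Sum.inl j))
  have hstrict := inner_lt_of_mem_sideCut ha hW hline hx
  have hmove : ∀ k, dirOf (conNormal a ν i) k = d → Active (conNormal a ν i) C k → ∀ ε : ℝ,
      inner ℝ (conNormal a ν i k) (x + ε • (d : Plane)) = C k + ε * ‖conNormal a ν i k‖ := by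
    intro k hk hact ε
    have e1 : C k = _ := conOffset_eq_of_active ha hact
    have hu : unitDir (conNormal a ν i k) = d := congrArg Subtype.val hk
    rw [inner_eq_norm_mul_inner_unitDir, hu, inner_add_right, inner_smul_right, hline,
      real_inner_self_eq_norm_sq, hd1, e1, hk]
    ring
  have hev : ∀ k, (dirOf (conNormal a ν i) k = d → ¬ Active (conNormal a ν i) C k) →
      ∀ᶠ ε : ℝ in 𝓝 0, inner ℝ (conNormal a ν i k) (x + ε • (d : Plane)) < C k := by
    intro k hk
    have hc : Continuous fun ε : ℝ => inner ℝ (conNormal a ν i k) (x + ε • (d : Plane)) := by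
      fun_prop
    refine hc.continuousAt.eventually_lt continuousAt_const ?_
    simpa using hstrict k hk
  have htend : Tendsto (fun ε : ℝ => x + ε • (d : Plane)) (𝓝 0) (𝓝 x) := by
    have hc : Continuous fun ε : ℝ => x + ε • (d : Plane) := by fun_prop
    simpa using hc.tendsto 0
  constructor
  -- Stepping inward makes the constraints on this line strict and keeps the others strict.
  · refine mem_closure_of_tendsto (htend.mono_left (nhdsWithin_le_nhds (s := Iio 0))) ?_
    rw [region_eq_constraints hint]
    have : ∀ᶠ ε : ℝ in 𝓝[<] 0, ∀ k, inner ℝ (conNormal a ν i k) (x + ε • (d : Plane)) < C k := by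
      rw [eventually_all]
      intro k
      by_cases hk : dirOf (conNormal a ν i) k = d ∧ Active (conNormal a ν i) C k
      · filter_upwards [self_mem_nhdsWithin] with ε hε
        rw [hmove k hk.1 hk.2]
        have : 0 < ‖conNormal a ν i k‖ := norm_pos_iff.2 (conNormal_ne_zero ha i k)
        nlinarith [mul_pos_of_neg_of_neg (show ε < 0 from hε) (neg_neg_of_pos this)]
      · exact (hev k fun h1 h2 => hk ⟨h1, h2⟩).filter_mono nhdsWithin_le_nhds
    exact this
  -- Stepping outward, `j` gains `ε * ‖a j - a i‖` over `i`; rivals on the same line are strictly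
  -- nearer to `a i` and gain less, and all other rivals stay below `i`.
  · refine mem_closure_of_tendsto (htend.mono_left (nhdsWithin_le_nhds (s := Ioi 0))) ?_
    have hpolE : ∀ᶠ ε : ℝ in 𝓝[>] 0, ∀ l : {l : Fin m // ν l ≠ 0},
        inner ℝ (ν l) (x + ε • (d : Plane)) < ζ l := by
      rw [eventually_all]
      intro l
      exact (hev (Sum.inr l) (hpol l)).filter_mono nhdsWithin_le_nhds
    have hcomp : ∀ᶠ ε : ℝ in 𝓝[>] 0, ∀ j' : {j : Fin n // j ≠ i}, (j' : Fin n) ≠ j →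
        inner ℝ (a j' - a i) (x + ε • (d : Plane)) - (ξ j' - ξ i) < ε * ‖a j - a i‖ := by
      simp only [eventually_all]
      intro j' hne
      by_cases hk : dirOf (conNormal a ν i) (Sum.inl j') = d ∧
          Active (conNormal a ν i) C (Sum.inl j')
      · filter_upwards [self_mem_nhdsWithin] with ε hε
        have h1 : inner ℝ (a j' - a i) (x + ε • (d : Plane)) = (ξ j' - ξ i) + ε * ‖a j' - a i‖ :=
          hmove (Sum.inl j') hk.1 hk.2 ε
        have h2 := hmax j' hk.1 hk.2
        have h3 : ‖a j' - a i‖ ≠ ‖a j - a i‖ := by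
          intro h
          have hu1 : unitDir (a j' - a i) = d := congrArg Subtype.val hk.1
          have hu2 : unitDir (a j - a i) = d := congrArg Subtype.val hjd
          have h4 : a j' - a i = a j - a i := by
            rw [← norm_smul_unitDir (a j' - a i), ← norm_smul_unitDir (a j - a i), hu1, hu2, h]
          exact hne (ha (sub_left_injective h4))
        rw [h1, add_sub_cancel_left]
        exact mul_lt_mul_of_pos_left (lt_of_le_of_ne h2 h3) hε
      · filter_upwards [(hev (Sum.inl j') fun h1 h2 => hk ⟨h1, h2⟩).filter_mono
          nhdsWithin_le_nhds, self_mem_nhdsWithin] with ε h1 hε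
        have h1' : inner ℝ (a j' - a i) (x + ε • (d : Plane)) < ξ j' - ξ i := h1
        have : 0 ≤ ε * ‖a j - a i‖ := mul_nonneg (le_of_lt hε) (norm_nonneg _)
        linarith
    filter_upwards [hpolE, hcomp, self_mem_nhdsWithin] with ε h1 h2 hε
    have h3 : inner ℝ (a j - a i) (x + ε • (d : Plane)) = (ξ j - ξ i) + ε * ‖a j - a i‖ :=
      hmove (Sum.inl j) hjd hj ε
    rw [inner_sub_left] at h3
    refine ⟨?_, fun j' hj' => ?_⟩
    · rw [hint]
      exact fun l hl => h1 ⟨l, hl⟩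
    · by_cases hi : j' = i
      · have : 0 < ‖a j - a i‖ := norm_pos_iff.2 (sub_ne_zero.2 (ha.ne j.2))
        have : 0 < ε * ‖a j - a i‖ := mul_pos hε this
        rw [hi]
        linarith
      · have h4 := h2 ⟨j', hi⟩ hj'
        rw [inner_sub_left] at h4
        linarith

/-- The weight of the edge shared with the farthest competitor defining a bounding line. -/
lemma edgeWeight_eq_sideMass (ha : Function.Injective a)
    (hint : interior D = {x | ∀ l, ν l ≠ 0 → inner ℝ (ν l) x < ζ l}) (ρ : Plane → ℝ)
    {i : Fin n} {ξ : EuclideanSpace ℝ (Fin n)} {d : dirs (conNormal a ν i)}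
    (hW : Wide (Subtype.val : dirs (conNormal a ν i) → Plane)
      (dirOffset (conNormal a ν i) (conOffset ν ζ i ξ)))
    (hpol : ∀ l, dirOf (conNormal a ν i) (Sum.inr l) = d →
      ¬ Active (conNormal a ν i) (conOffset ν ζ i ξ) (Sum.inr l))
    (j : {j : Fin n // j ≠ i}) (hjd : dirOf (conNormal a ν i) (Sum.inl j) = d)
    (hj : Active (conNormal a ν i) (conOffset ν ζ i ξ) (Sum.inl j))
    (hmax : ∀ j', dirOf (conNormal a ν i) (Sum.inl j') = d →
      Active (conNormal a ν i) (conOffset ν ζ i ξ) (Sum.inl j') →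
      ‖a j' - a i‖ ≤ ‖a j - a i‖) :
    edgeWeight D a ρ ξ i j * ‖a j - a i‖
      = sideMass ρ (Subtype.val : dirs (conNormal a ν i) → Plane) d
        (dirOffset (conNormal a ν i) (conOffset ν ζ i ξ)) := by
  set C := conOffset ν ζ i ξ with hC
  have hunit : ∀ d' : dirs (conNormal a ν i), ‖(d' : Plane)‖ = 1 := by
    intro d'
    obtain ⟨k, hk⟩ := dirClass_nonempty (conNormal a ν i) d'
    rw [← mem_dirClass.1 hk]
    exact norm_unitDir (conNormal_ne_zero ha i k)
  have hu : unitDir (a j - a i) = d := congrArg Subtype.val hjd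
  have ho : (ξ j - ξ i) / ‖a j - a i‖ = dirOffset (conNormal a ν i) C d := by rw [← hjd]; exact hj
  have hne : ‖a j - a i‖ ≠ 0 := norm_ne_zero_iff.2 (sub_ne_zero.2 (ha.ne j.2))
  rw [edgeWeight_eq_integral ha ρ j.2, sideMass, if_pos hW, lineMass, hu, ho, mul_comm,
    ← mul_assoc, mul_one_div_cancel hne, one_mul]
  refine integral_congr_ae ?_
  -- The closed edge and the open `sideCut` can differ only where a transversal bounding line
  -- crosses, that is, at finitely many `s`.
  have hae : ∀ᵐ s : ℝ, ∀ d' : dirs (conNormal a ν i), (d' : Plane) ≠ d → (d' : Plane) ≠ -d →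
      inner ℝ (d' : Plane) (frame d (dirOffset (conNormal a ν i) C d, s))
        ≠ dirOffset (conNormal a ν i) C d' := by
    rw [ae_all_iff]
    intro d'
    by_cases h1 : (d' : Plane) = d
    · simp [h1]
    by_cases h2 : (d' : Plane) = -d
    · simp [h2]
    filter_upwards [ae_line_ne (hunit d) (hunit d') h1 h2
      (dirOffset (conNormal a ν i) C d) (dirOffset (conNormal a ν i) C d')]
      with s hs _ _ using hs
  filter_upwards [hae] with s hs
  have hiff : frame d (dirOffset (conNormal a ν i) C d, s) ∈ edge D a ξ i j ↔
      frame d (dirOffset (conNormal a ν i) C d, s) ∈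
        sideCut (Subtype.val : dirs (conNormal a ν i) → Plane) d (dirOffset (conNormal a ν i) C) := by
    constructor
    · intro h d' h1 h2
      refine lt_of_le_of_ne ?_ (hs d' h1 h2)
      obtain ⟨k, rfl, hact⟩ := exists_active (conNormal a ν i) C d'
      have h3 := inner_le_of_mem_closure hint i h.1 k
      rw [inner_eq_norm_mul_inner_unitDir, mul_comm,
        ← le_div_iff₀ (norm_pos_iff.2 (conNormal_ne_zero ha i k))] at h3
      rw [← hact]
      exact h3
    · exact mem_edge_of_mem_sideCut ha hint hW hpol j hjd hj hmax (inner_frame (hunit d) _)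
  by_cases h : frame d (dirOffset (conNormal a ν i) C d, s) ∈ edge D a ξ i j
  · rw [indicator_of_mem h, indicator_of_mem (hiff.1 h)]
  · rw [indicator_of_notMem h, indicator_of_notMem fun hc => h (hiff.2 hc)]

/-- The weights of the edges on a bounding line account for the displacement of that line. -/
lemma sum_dirClass_edgeWeight (ha : Function.Injective a)
    (hint : interior D = {x | ∀ l, ν l ≠ 0 → inner ℝ (ν l) x < ζ l}) (ρ : Plane → ℝ)
    {i : Fin n} {ξ ξ₀ : EuclideanSpace ℝ (Fin n)}
    (hact : ∀ k, Active (conNormal a ν i) (conOffset ν ζ i ξ) k →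
      Active (conNormal a ν i) (conOffset ν ζ i ξ₀) k) (d : dirs (conNormal a ν i)) :
    ∑ k ∈ dirClass (conNormal a ν i) d,
        Sum.elim (fun j : {j : Fin n // j ≠ i} => edgeWeight D a ρ ξ i j) (fun _ => 0) k
          * (conOffset ν ζ i ξ k - conOffset ν ζ i ξ₀ k)
      = sideMass ρ (Subtype.val : dirs (conNormal a ν i) → Plane) d
          (dirOffset (conNormal a ν i) (conOffset ν ζ i ξ))
        * (dirOffset (conNormal a ν i) (conOffset ν ζ i ξ) d
          - dirOffset (conNormal a ν i) (conOffset ν ζ i ξ₀) d) := by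
  set C := conOffset ν ζ i ξ with hC
  set C₀ := conOffset ν ζ i ξ₀ with hC₀
  have hb0 : ∀ k, (conNormal a ν i) k ≠ 0 := conNormal_ne_zero ha i
  have hinact : ∀ j : {j : Fin n // j ≠ i}, ¬ Active (conNormal a ν i) C (Sum.inl j) →
      edgeWeight D a ρ ξ i j = 0 := by
    intro j hj
    apply edgeWeight_eq_zero_of_edge_eq_empty
    by_contra! hne
    exact hj (active_of_edge_nonempty ha hint j hne)
  by_cases hW : Wide (Subtype.val : dirs (conNormal a ν i) → Plane) (dirOffset (conNormal a ν i) C)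
  · by_cases hpol : ∃ l, dirOf (conNormal a ν i) (Sum.inr l) = d ∧
        Active (conNormal a ν i) C (Sum.inr l)
    · obtain ⟨l, hl, hl'⟩ := hpol
      -- The offset of a side of `D` is fixed, so an active one, being active at `ξ₀` too, shows
      -- that the line has not moved.
      have hzero : dirOffset (conNormal a ν i) C d - dirOffset (conNormal a ν i) C₀ d = 0 := by
        have h1 := sub_eq_of_active hb0 hl' (hact _ hl')
        have h2 : C (Sum.inr l) - C₀ (Sum.inr l) = 0 := sub_self (ζ l)
        rw [h2, hl] at h1
        exact (mul_eq_zero.1 h1.symm).resolve_left (norm_ne_zero_iff.2 (hb0 _))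
      rw [hzero, mul_zero]
      refine Finset.sum_eq_zero fun k hk => ?_
      rcases k with j | l'
      · by_cases hj : Active (conNormal a ν i) C (Sum.inl j)
        · rw [sub_eq_of_active hb0 hj (hact _ hj), mem_dirClass.1 hk, hzero, mul_zero, mul_zero]
        · rw [Sum.elim_inl, hinact j hj, zero_mul]
      · rw [Sum.elim_inr, zero_mul]
    · push Not at hpol
      classical
      obtain ⟨k₀, hk₀, hk₀'⟩ := exists_active (conNormal a ν i) C d
      have hne : (Finset.univ.filter fun j : {j : Fin n // j ≠ i} =>
          dirOf (conNormal a ν i) (Sum.inl j) = d ∧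
            Active (conNormal a ν i) C (Sum.inl j)).Nonempty := by
        rcases k₀ with j | l
        · exact ⟨j, by simp [hk₀, hk₀']⟩
        · exact absurd hk₀' (hpol l hk₀)
      obtain ⟨j, hjmem, hjmax⟩ := Finset.exists_max_image _
        (fun j : {j : Fin n // j ≠ i} => ‖a j - a i‖) hne
      simp only [Finset.mem_filter, Finset.mem_univ, true_and] at hjmem hjmax
      have hmain := edgeWeight_eq_sideMass ha hint ρ hW hpol j hjmem.1 hjmem.2
        fun j' h1 h2 => hjmax j' ⟨h1, h2⟩
      rw [Finset.sum_eq_single (Sum.inl j : ConIndex ν i)]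
      · rw [Sum.elim_inl, sub_eq_of_active hb0 hjmem.2 (hact _ hjmem.2), hjmem.1, ← hmain,
          mul_assoc]
        rfl
      · intro k hk hkj
        rcases k with j' | l
        · rw [Sum.elim_inl]
          by_cases hj' : Active (conNormal a ν i) C (Sum.inl j')
          · have hdir' := mem_dirClass.1 hk
            have hle := hjmax j' ⟨hdir', hj'⟩
            have hlt : ‖a j' - a i‖ < ‖a j - a i‖ := by
              refine lt_of_le_of_ne hle fun h => hkj ?_
              have hu1 : unitDir (a j' - a i) = d := congrArg Subtype.val hdir'
              have hu2 : unitDir (a j - a i) = d := congrArg Subtype.val hjmem.1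
              have h4 : a j' - a i = a j - a i := by
                rw [← norm_smul_unitDir (a j' - a i), ← norm_smul_unitDir (a j - a i), hu1, hu2, h]
              rw [Subtype.ext (ha (sub_left_injective h4))]
            have hempty := region_eq_empty_of_active (D := D) ha j' j hj' hjmem.2
              (hdir'.trans hjmem.1.symm) hlt
            rw [edgeWeight_eq_zero_of_edge_eq_empty, zero_mul]
            rw [edge, hempty, closure_empty, inter_empty]
          · rw [hinact j' hj', zero_mul]
        · rw [Sum.elim_inr, zero_mul]
      · intro h
        exact absurd (mem_dirClass.2 hjmem.1) h
  · rw [sideMass, if_neg hW, zero_mul]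
    have hempty : region D a ξ i = ∅ := by
      rw [region_eq_constraints hint, ← poly_dirOffset hb0]
      exact poly_eq_empty_of_not_wide hW
    refine Finset.sum_eq_zero fun k _ => ?_
    rcases k with j | l
    · rw [Sum.elim_inl, edgeWeight_eq_zero_of_edge_eq_empty, zero_mul]
      rw [edge, hempty, closure_empty, empty_inter]
    · rw [Sum.elim_inr, zero_mul]

/-- First order expansion of the mass of a region, with the edge weights taken at the varying
point. -/
theorem region_mass_sub_isLittleO (ha : Function.Injective a)
    (hint : interior D = {x | ∀ l, ν l ≠ 0 → inner ℝ (ν l) x < ζ l}) {ρ : Plane → ℝ}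
    (hρ : Continuous ρ) (hs : HasCompactSupport ρ) (i : Fin n)
    (ξ₀ : EuclideanSpace ℝ (Fin n)) :
    (fun ξ : EuclideanSpace ℝ (Fin n) => (∫ x in region D a ξ i, ρ x)
        - (∫ x in region D a ξ₀ i, ρ x)
        - ∑ j ∈ Finset.univ.erase i, edgeWeight D a ρ ξ i j * ((ξ - ξ₀) j - (ξ - ξ₀) i))
      =o[𝓝 ξ₀] (fun ξ => ξ - ξ₀) := by
  have hb0 : ∀ k, conNormal a ν i k ≠ 0 := conNormal_ne_zero ha i
  have hcont : Tendsto (conOffset ν ζ i) (𝓝 ξ₀) (𝓝 (conOffset ν ζ i ξ₀)) :=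
    (continuous_conOffset i).tendsto ξ₀
  have h1 := ((setIntegral_constraints_sub_isLittleO hρ hs hb0
    (conOffset ν ζ i ξ₀)).comp_tendsto hcont).trans_isBigO (conOffset_sub_isBigO i ξ₀)
  refine h1.congr' ?_ EventuallyEq.rfl
  filter_upwards [hcont.eventually (eventually_active (conNormal a ν i) (conOffset ν ζ i ξ₀))]
    with ξ hξ
  simp only [Function.comp_apply]
  rw [region_eq_constraints hint, region_eq_constraints hint]
  congr 1
  classical
  -- Directions partition the constraints and the sides of `D` have weight zero, so the sum over
  -- directions becomes a sum over competitors.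
  rw [← Finset.sum_congr rfl fun d _ => sum_dirClass_edgeWeight ha hint ρ hξ d]
  simp only [dirClass]
  rw [Finset.sum_fiberwise, Fintype.sum_sum_type]
  simp only [Sum.elim_inl, Sum.elim_inr, zero_mul, Finset.sum_const_zero, add_zero]
  have h2 : ∀ f : Fin n → ℝ, ∑ j ∈ Finset.univ.erase i, f j = ∑ j : {j : Fin n // j ≠ i}, f j := by
    intro f
    refine Finset.sum_subtype _ (fun j => ?_) f
    simp
  rw [h2]
  refine Finset.sum_congr rfl fun j _ => ?_
  simp only [conOffset, Sum.elim_inl, PiLp.sub_apply]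
  ring

end EdgeConstraints

/-! ### Newton differentiability of the region masses -/

/-- Tietze extension times a cutoff equal to `1` on `D`. The polygon calculus moves sides freely and
so needs a density continuous on the whole plane. -/
lemma exists_compactSupport_extension {D : Set Plane} (hD : IsCompact D) {ϱ : Plane → ℝ}
    (hϱ : ContinuousOn ϱ D) :
    ∃ ρ : Plane → ℝ, Continuous ρ ∧ HasCompactSupport ρ ∧ EqOn ϱ ρ D := by
  obtain ⟨f, hf⟩ := ContinuousMap.exists_restrict_eq hD.isClosed
    (⟨D.domRestrict ϱ, hϱ.domRestrict⟩ : C(D, ℝ))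
  obtain ⟨χ, hχ1, -, hχs, -⟩ :=
    exists_continuous_one_zero_of_isCompact hD isClosed_empty (disjoint_empty D)
  refine ⟨fun x => χ x * f x, χ.continuous.mul f.continuous, hχs.mul_right, fun x hx => ?_⟩
  have h1 : f x = ϱ x := congrArg (fun F : C(D, ℝ) => F ⟨x, hx⟩) hf
  have h2 : χ x = 1 := hχ1 hx
  simp only [h1, h2, one_mul]

section Mass

variable {n : ℕ} {D : Set Plane} {a : Fin n → Plane} {ϱ ρ : Plane → ℝ}

lemma withDensity_region (hEq : EqOn ϱ ρ D) (ξ : EuclideanSpace ℝ (Fin n)) (i : Fin n) :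
    ((volume.restrict D).withDensity fun x => ENNReal.ofReal (ϱ x)) (region D a ξ i)
      = ∫⁻ x in region D a ξ i, ENNReal.ofReal (ρ x) := by
  have hm : MeasurableSet (region D a ξ i) := (isOpen_region i).measurableSet
  rw [withDensity_apply _ hm, Measure.restrict_restrict_of_subset (region_subset i)]
  exact setLIntegral_congr_fun hm fun x hx => by
    simp only [hEq (region_subset i hx)]

lemma uTilde_apply (hEq : EqOn ϱ ρ D) (hρ : Continuous ρ) (hϱ_nonneg : ∀ x ∈ D, 0 ≤ ϱ x)
    (ξ : EuclideanSpace ℝ (Fin n)) (i : Fin n) :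
    uTilde D a ((volume.restrict D).withDensity fun x => ENNReal.ofReal (ϱ x)) ξ i
      = ∫ x in region D a ξ i, ρ x := by
  have hm : MeasurableSet (region D a ξ i) := (isOpen_region i).measurableSet
  rw [integral_eq_lintegral_of_nonneg_ae _ hρ.aestronglyMeasurable, ← withDensity_region hEq]
  · rfl
  · filter_upwards [ae_restrict_mem hm] with x hx
    have hxD := region_subset i hx
    exact (hEq hxD) ▸ hϱ_nonneg x hxD

/-- Regions without mass have no weighted edges. -/
lemma edgeWeight_eq_zero_of_mass_eq_zero (hD : IsClosed D) (hEq : EqOn ϱ ρ D)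
    (hρ : Continuous ρ) (hϱ_nonneg : ∀ x ∈ D, 0 ≤ ϱ x) {ξ : EuclideanSpace ℝ (Fin n)} {i : Fin n}
    (h : ((volume.restrict D).withDensity fun x => ENNReal.ofReal (ϱ x)) (region D a ξ i) = 0)
    (j : Fin n) : edgeWeight D a ϱ ξ i j = 0 := by
  have hm : MeasurableSet (region D a ξ i) := (isOpen_region i).measurableSet
  rw [withDensity_region hEq, lintegral_eq_zero_iff (by fun_prop)] at h
  have hpos : IsOpen (region D a ξ i ∩ {x | 0 < ρ x}) :=
    (isOpen_region i).inter (isOpen_lt continuous_const hρ)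
  have hnull : volume (region D a ξ i ∩ {x | 0 < ρ x}) = 0 := by
    have h1 : ∀ᵐ x : Plane, x ∉ region D a ξ i ∩ {x | 0 < ρ x} := by
      filter_upwards [(ae_restrict_iff' hm).1 h] with x hx hx'
      have h2 := hx hx'.1
      simp only [Pi.zero_apply, ENNReal.ofReal_eq_zero] at h2
      exact not_lt.2 h2 hx'.2
    exact measure_eq_zero_iff_ae_notMem.2 h1
  rw [hpos.measure_eq_zero_iff volume] at hnull
  -- The density vanishes on the open region, hence by continuity on its closure, which contains the
  -- edges.
  have hzero : closure (region D a ξ i) ⊆ {x | ρ x = 0} := by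
    refine closure_minimal (fun x hx => ?_) (isClosed_eq hρ continuous_const)
    have hxD := region_subset i hx
    have h1 : 0 ≤ ρ x := (hEq hxD) ▸ hϱ_nonneg x hxD
    by_contra hne
    have : x ∈ region D a ξ i ∩ {x | 0 < ρ x} := ⟨hx, lt_of_le_of_ne h1 (Ne.symm hne)⟩
    rw [hnull] at this
    exact this
  rw [edgeWeight_congr hD hEq, edgeWeight, setIntegral_eq_zero_of_forall_eq_zero, mul_zero]
  exact fun x hx => hzero hx.1

/-- The matrix `Theta` acts as a weighted graph Laplacian. -/
lemma toEuclideanCLM_Theta_apply (hD : IsClosed D) (hEq : EqOn ϱ ρ D)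
    (hρ : Continuous ρ) (hϱ_nonneg : ∀ x ∈ D, 0 ≤ ϱ x) (ξ v : EuclideanSpace ℝ (Fin n))
    (i : Fin n) :
    Matrix.toEuclideanCLM (𝕜 := ℝ)
        (Theta D a ((volume.restrict D).withDensity fun x => ENNReal.ofReal (ϱ x)) ϱ ξ) v i
      = ∑ j ∈ Finset.univ.erase i, edgeWeight D a ρ ξ i j * (v j - v i) := by
  rw [Matrix.ofLp_toEuclideanCLM, Matrix.mulVec, dotProduct,
    ← Finset.add_sum_erase _ _ (Finset.mem_univ i)]
  simp only [← edgeWeight_congr hD hEq]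
  by_cases h : 0 < ((volume.restrict D).withDensity fun x => ENNReal.ofReal (ϱ x))
    (region D a ξ i)
  · have h1 : ∀ k ∈ Finset.univ.erase i,
        Theta D a ((volume.restrict D).withDensity fun x => ENNReal.ofReal (ϱ x)) ϱ ξ i k * v k
          = edgeWeight D a ϱ ξ i k * v k := by
      intro k hk
      simp only [Theta, Matrix.of_apply, if_pos h, if_neg (Finset.ne_of_mem_erase hk)]
    rw [Finset.sum_congr rfl h1]
    simp only [Theta, Matrix.of_apply, if_pos h, if_true]
    rw [neg_mul, Finset.sum_mul, neg_add_eq_sub, ← Finset.sum_sub_distrib]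
    exact Finset.sum_congr rfl fun j _ => by ring
  -- The prescribed zero row agrees with the Laplacian row, all of whose weights vanish.
  · have h0 := edgeWeight_eq_zero_of_mass_eq_zero hD hEq hρ hϱ_nonneg
      (le_antisymm (not_lt.1 h) bot_le)
    simp only [Theta, Matrix.of_apply, if_neg h, h0, zero_mul, Finset.sum_const_zero, add_zero]

/-- Newton differentiability of the vector of region masses with Newton derivative `Theta`. -/
theorem uTilde_sub_isLittleO (ha : Function.Injective a) (hD : IsConvexPolygon D)
    (hEq : EqOn ϱ ρ D) (hρ : Continuous ρ) (hs : HasCompactSupport ρ)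
    (hϱ_nonneg : ∀ x ∈ D, 0 ≤ ϱ x) {ud : Measure Plane}
    (hud : ud = (volume.restrict D).withDensity fun x => ENNReal.ofReal (ϱ x))
    (ξ₀ : EuclideanSpace ℝ (Fin n)) :
    (fun ξ => uTilde D a ud ξ - uTilde D a ud ξ₀
        - Matrix.toEuclideanCLM (𝕜 := ℝ) (Theta D a ud ϱ ξ) (ξ - ξ₀))
      =o[𝓝 ξ₀] (fun ξ => ξ - ξ₀) := by
  subst hud
  obtain ⟨hcomp, hne, m, ν, ζ, hDeq⟩ := hD
  have hint : interior D = {x | ∀ l, ν l ≠ 0 → inner ℝ (ν l) x < ζ l} := by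
    have hne' := hne.mono interior_subset
    rw [hDeq] at hne' ⊢
    exact interior_polygon ν ζ hne'
  set e := (PiLp.continuousLinearEquiv 2 ℝ (fun _ : Fin n => ℝ)).symm
  set f := fun ξ => uTilde D a ((volume.restrict D).withDensity fun x => ENNReal.ofReal (ϱ x)) ξ
    - uTilde D a ((volume.restrict D).withDensity fun x => ENNReal.ofReal (ϱ x)) ξ₀
    - Matrix.toEuclideanCLM (𝕜 := ℝ)
      (Theta D a ((volume.restrict D).withDensity fun x => ENNReal.ofReal (ϱ x)) ϱ ξ) (ξ - ξ₀)
    with hf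
  have h1 : (fun ξ => (f ξ).ofLp) =o[𝓝 ξ₀] (fun ξ => ξ - ξ₀) := by
    rw [Asymptotics.isLittleO_pi]
    intro i
    refine (region_mass_sub_isLittleO ha hint hρ hs i ξ₀).congr_left fun ξ => ?_
    rw [← uTilde_apply hEq hρ hϱ_nonneg, ← uTilde_apply hEq hρ hϱ_nonneg,
      ← toEuclideanCLM_Theta_apply hcomp.isClosed hEq hρ hϱ_nonneg]
    rfl
  have h2 : (fun ξ => e (f ξ).ofLp) =O[𝓝 ξ₀] (fun ξ => (f ξ).ofLp) :=
    (e : (Fin n → ℝ) →L[ℝ] EuclideanSpace ℝ (Fin n)).isBigO_comp _ _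
  exact h2.trans_isLittleO h1

end Mass

/-! ### Weighted graph Laplacians -/

/-- Cauchy–Schwarz with weights `w i j` bounds each squared row by `n * B` times its part of the
Dirichlet energy; by symmetry the total energy is twice the quadratic form of the negative
Laplacian. -/
lemma laplacian_sq_le {n : ℕ} {w : Fin n → Fin n → ℝ} {B : ℝ} (hw0 : ∀ i j, 0 ≤ w i j)
    (hsymm : ∀ i j, w i j = w j i) (hB : ∀ i j, w i j ≤ B) (v : Fin n → ℝ) :
    ∑ i, (∑ j, w i j * (v j - v i)) ^ 2
      ≤ 2 * (n * B) * -∑ i, (∑ j, w i j * (v j - v i)) * v i := by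
  have h1 : ∀ i, (∑ j, w i j * (v j - v i)) ^ 2 ≤ n * B * ∑ j, w i j * (v j - v i) ^ 2 := by
    intro i
    have hcs := Finset.sum_sq_le_sum_mul_sum_of_sq_le_mul Finset.univ
      (r := fun j => w i j * (v j - v i)) (f := fun j => w i j)
      (g := fun j => w i j * (v j - v i) ^ 2) (fun j _ => hw0 i j)
      (fun j _ => mul_nonneg (hw0 i j) (sq_nonneg _)) (fun j _ => le_of_eq (by ring))
    refine hcs.trans (mul_le_mul_of_nonneg_right ?_
      (Finset.sum_nonneg fun j _ => mul_nonneg (hw0 i j) (sq_nonneg _)))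
    calc ∑ j, w i j ≤ ∑ _j : Fin n, B := Finset.sum_le_sum fun j _ => hB i j
      _ = n * B := by simp
  have h2 : ∑ i, ∑ j, w i j * (v j - v i) ^ 2 = 2 * -∑ i, (∑ j, w i j * (v j - v i)) * v i := by
    have hswap : ∑ i, ∑ j, w i j * (v j - v i) * v j = -∑ i, ∑ j, w i j * (v j - v i) * v i := by
      rw [Finset.sum_comm, ← Finset.sum_neg_distrib]
      refine Finset.sum_congr rfl fun i _ => ?_
      rw [← Finset.sum_neg_distrib]
      refine Finset.sum_congr rfl fun j _ => ?_
      rw [hsymm j i]; ring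
    have hexp : ∑ i, ∑ j, w i j * (v j - v i) ^ 2
        = ∑ i, ∑ j, w i j * (v j - v i) * v j - ∑ i, ∑ j, w i j * (v j - v i) * v i := by
      rw [← Finset.sum_sub_distrib]
      refine Finset.sum_congr rfl fun i _ => ?_
      rw [← Finset.sum_sub_distrib]
      exact Finset.sum_congr rfl fun j _ => by ring
    rw [hexp, hswap]
    simp only [Finset.sum_mul]
    ring
  calc ∑ i, (∑ j, w i j * (v j - v i)) ^ 2
      ≤ ∑ i, n * B * ∑ j, w i j * (v j - v i) ^ 2 := Finset.sum_le_sum fun i _ => h1 i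
    _ = n * B * ∑ i, ∑ j, w i j * (v j - v i) ^ 2 := by rw [Finset.mul_sum]
    _ = _ := by rw [h2]; ring

/-- The operators `Theta` are uniformly cocoercive, up to sign. -/
theorem exists_Theta_cocoercive {n : ℕ} {D : Set Plane} {a : Fin n → Plane} {ϱ ρ : Plane → ℝ}
    (ha : Function.Injective a) (hD : IsClosed D)
    (hEq : EqOn ϱ ρ D) (hρ : Continuous ρ) (hs : HasCompactSupport ρ)
    (hϱ_nonneg : ∀ x ∈ D, 0 ≤ ϱ x) {ud : Measure Plane}
    (hud : ud = (volume.restrict D).withDensity fun x => ENNReal.ofReal (ϱ x)) :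
    ∃ L : ℝ, 0 ≤ L ∧ ∀ ξ v : EuclideanSpace ℝ (Fin n),
      ‖Matrix.toEuclideanCLM (𝕜 := ℝ) (Theta D a ud ϱ ξ) v‖ ^ 2
        ≤ L * -inner ℝ (Matrix.toEuclideanCLM (𝕜 := ℝ) (Theta D a ud ϱ ξ) v) v := by
  subst hud
  obtain ⟨B, hB0, hB⟩ := exists_edgeWeight_le (D := D) ha hρ hs
  refine ⟨2 * (n * B), by positivity, fun ξ v => ?_⟩
  have hT : ∀ i, Matrix.toEuclideanCLM (𝕜 := ℝ)
        (Theta D a ((volume.restrict D).withDensity fun x => ENNReal.ofReal (ϱ x)) ϱ ξ) v i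
      = ∑ j, edgeWeight D a ρ ξ i j * (v j - v i) := by
    intro i
    rw [toEuclideanCLM_Theta_apply hD hEq hρ hϱ_nonneg,
      ← Finset.add_sum_erase _ _ (Finset.mem_univ i), sub_self, mul_zero, zero_add]
  have hρ_nonneg : ∀ x ∈ D, 0 ≤ ρ x := fun x hx => hEq hx ▸ hϱ_nonneg x hx
  have key := laplacian_sq_le (w := fun i j => edgeWeight D a ρ ξ i j) (B := B)
    (fun i j => edgeWeight_nonneg hD hρ_nonneg i j) (fun i j => edgeWeight_comm ρ i j)
    (fun i j => ?_) v
  · rw [EuclideanSpace.norm_sq_eq, PiLp.inner_apply]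
    simp only [hT, Real.norm_eq_abs, sq_abs]
    refine key.trans (le_of_eq ?_)
    congr 2
    refine Finset.sum_congr rfl fun i _ => ?_
    simp [mul_comm]
  · by_cases hij : j = i
    · subst hij
      -- On the diagonal the prefactor is `1 / 0 = 0`, whatever the set `edge` is.
      simpa [edgeWeight] using hB0
    · exact hB ξ i j hij

/-! ### The Hessian of a convex function -/

section Hessian

variable {E : Type*} [NormedAddCommGroup E] [InnerProductSpace ℝ E] [CompleteSpace E]

lemma contDiff_gradient {g : E → ℝ} (hg : ContDiff ℝ 2 g) : ContDiff ℝ 1 (gradient g) := by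
  have h1 : ContDiff ℝ 1 (fderiv ℝ g) := hg.fderiv_right (by norm_num)
  exact (InnerProductSpace.toDual ℝ E).symm.contDiff.comp h1

/-- Restricted to a line, `g` is convex, so its derivative is monotone; the derivative of that at
`0` is the Hessian form. -/
lemma inner_hessian_nonneg {g : E → ℝ} (hg : ContDiff ℝ 2 g) (hconv : ConvexOn ℝ univ g)
    (u v : E) : 0 ≤ inner ℝ v (fderiv ℝ (gradient g) u v) := by
  have hline : ∀ t : ℝ, HasDerivAt (fun t : ℝ => u + t • v) v t := by
    intro t
    simpa using ((hasDerivAt_id t).smul_const v).const_add u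
  have hφ : ∀ t : ℝ, HasDerivAt (fun t : ℝ => g (u + t • v))
      (inner ℝ (gradient g (u + t • v)) v) t := by
    intro t
    have h1 := (hg.differentiable (by norm_num) (u + t • v)).hasFDerivAt.comp_hasDerivAt t (hline t)
    have h2 : inner ℝ (gradient g (u + t • v)) v = fderiv ℝ g (u + t • v) v := by
      simp [gradient]
    rw [h2]
    exact h1
  have hderiv : deriv (fun t : ℝ => g (u + t • v))
      = fun t => inner ℝ (gradient g (u + t • v)) v := funext fun t => (hφ t).deriv
  have hcv : ConvexOn ℝ univ (fun t : ℝ => g (u + t • v)) := by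
    refine ⟨convex_univ, fun s _ t _ p q hp hq hpq => ?_⟩
    have h := hconv.2 (mem_univ (u + s • v)) (mem_univ (u + t • v)) hp hq hpq
    have harg : u + (p • s + q • t) • v = p • (u + s • v) + q • (u + t • v) := by
      calc u + (p • s + q • t) • v = (p + q) • u + (p • s + q • t) • v := by rw [hpq, one_smul]
        _ = _ := by simp only [smul_eq_mul]; module
    simp only [harg]
    exact h
  have hmono : Monotone fun t : ℝ => inner ℝ (gradient g (u + t • v)) v := by
    rw [← hderiv]
    exact monotoneOn_univ.1 (hcv.monotoneOn_deriv fun t _ => (hφ t).differentiableAt)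
  have h1 : HasDerivAt (fun t : ℝ => gradient g (u + t • v)) (fderiv ℝ (gradient g) u v) 0 := by
    have hd := ((contDiff_gradient hg).differentiable (by norm_num)
      (u + (0 : ℝ) • v)).hasFDerivAt.comp_hasDerivAt 0 (hline 0)
    rw [zero_smul, add_zero] at hd
    exact hd
  have h2 : HasDerivAt (fun t : ℝ => inner ℝ (gradient g (u + t • v)) v)
      (inner ℝ (fderiv ℝ (gradient g) u v) v) 0 := by
    simpa using h1.inner ℝ (hasDerivAt_const (0 : ℝ) v)
  rw [real_inner_comm, ← h2.deriv]
  exact hmono.deriv_nonneg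

end Hessian

/-! ### Local convergence of Newton's method -/

section Newton

variable {E : Type*} [NormedAddCommGroup E] [NormedSpace ℝ E]

/-- The new error is `-(A x)⁻¹ (F x - A x (x - xbar))`, so the uniform bound `K` makes it little-o
of the old one. Hypothesis `hlo` already forces `F xbar = 0`. -/
theorem newton_convergesQSuperlinearly {F : E → E} {A : E → E →L[ℝ] E} {xbar : E} {K : ℝ}
    (hinv : ∀ᶠ x in 𝓝 xbar, (A x).IsInvertible ∧ ∀ v, ‖v‖ ≤ K * ‖A x v‖)
    (hlo : (fun x => F x - A x (x - xbar)) =o[𝓝 xbar] (fun x => x - xbar)) :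
    ∃ δ : ℝ, 0 < δ ∧ ∀ x : ℕ → E, ‖x 0 - xbar‖ ≤ δ →
      (∀ k, x (k + 1) = x k - (A (x k)).inverse (F (x k))) →
      (∀ k, (A (x k)).IsInvertible) ∧ ConvergesQSuperlinearly x xbar := by
  have hstep : (fun x => x - (A x).inverse (F x) - xbar) =o[𝓝 xbar] (fun x => x - xbar) := by
    refine Asymptotics.IsBigO.trans_isLittleO (Asymptotics.IsBigO.of_bound K ?_) hlo
    filter_upwards [hinv] with x hx
    refine (hx.2 _).trans (le_of_eq ?_)
    have h1 : A x ((A x).inverse (F x)) = F x := (hx.1.inverse_apply_eq.1 rfl).symm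
    have h2 : x - (A x).inverse (F x) - xbar = (x - xbar) - (A x).inverse (F x) := by abel
    rw [h2, map_sub, h1, norm_sub_rev]
  -- Any factor below `1` would do: it keeps the iterates in the ball where `hinv` holds and gives
  -- convergence, after which `hstep` yields the superlinear rate.
  have hhalf := (Asymptotics.isLittleO_iff.1 hstep) (show (0 : ℝ) < 1 / 2 by norm_num)
  obtain ⟨δ, hδ, hball⟩ := Metric.nhds_basis_closedBall.eventually_iff.1 (hinv.and hhalf)
  refine ⟨δ, hδ, fun x hx0 hrec => ?_⟩
  have hdecay : ∀ k, ‖x k - xbar‖ ≤ δ * (1 / 2) ^ k := by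
    intro k
    induction k with
    | zero => simpa using hx0
    | succ k ih =>
      have hmem : x k ∈ Metric.closedBall xbar δ := by
        rw [mem_closedBall_iff_norm]
        exact ih.trans (mul_le_of_le_one_right hδ.le (pow_le_one₀ (by norm_num) (by norm_num)))
      have h1 := (hball hmem).2
      rw [← hrec k] at h1
      calc ‖x (k + 1) - xbar‖ ≤ 1 / 2 * ‖x k - xbar‖ := h1
        _ ≤ 1 / 2 * (δ * (1 / 2) ^ k) := by linarith
        _ = δ * (1 / 2) ^ (k + 1) := by ring
  have hmem : ∀ k, x k ∈ Metric.closedBall xbar δ := by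
    intro k
    rw [mem_closedBall_iff_norm]
    exact (hdecay k).trans
      (mul_le_of_le_one_right hδ.le (pow_le_one₀ (by norm_num) (by norm_num)))
  have htend : Tendsto x atTop (𝓝 xbar) := by
    rw [tendsto_iff_norm_sub_tendsto_zero]
    refine squeeze_zero (fun _ => norm_nonneg _) hdecay ?_
    simpa using (tendsto_pow_atTop_nhds_zero_of_lt_one (r := (1 / 2 : ℝ)) (by norm_num)
      (by norm_num)).const_mul δ
  refine ⟨fun k => (hball (hmem k)).1.1, htend, ?_⟩
  refine (hstep.comp_tendsto htend).congr_left fun k => ?_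
  simp only [Function.comp_apply, hrec k]

end Newton

/-! ### Uniform invertibility of the Newton derivative -/

section Invertibility

variable {E : Type*} [NormedAddCommGroup E] [InnerProductSpace ℝ E]

/-- A uniform lower bound for `α⁻¹ H T - I` with `H` monotone and `-T` cocoercive. -/
lemma norm_le_of_cocoercive {H T : E →L[ℝ] E} {β L M : ℝ} (hβ : 0 ≤ β) (hL : 0 ≤ L)
    (hH : ∀ v, 0 ≤ inner ℝ v (H v)) (hHM : ‖H‖ ≤ M)
    (hT : ∀ v, ‖T v‖ ^ 2 ≤ L * -inner ℝ (T v) v) (v : E) :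
    ‖v‖ ≤ (1 + β * M * L) * ‖(β • H.comp T - ContinuousLinearMap.id ℝ E) v‖ := by
  set p := T v with hp
  set w := (β • H.comp T - ContinuousLinearMap.id ℝ E) v with hw
  have hw' : w = β • H p - v := by simp [hw, hp]
  have hM : 0 ≤ M := (norm_nonneg _).trans hHM
  -- Pairing `w` with `p` gives `β ⟪p, H p⟫ - ⟪p, v⟫`, whose first term is nonnegative; cocoercivity
  -- then bounds `p` by `w`.
  have h1 : -inner ℝ p v ≤ ‖p‖ * ‖w‖ := by
    have h2 : inner ℝ p w = β * inner ℝ p (H p) - inner ℝ p v := by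
      rw [hw', inner_sub_right, inner_smul_right]
    have h3 := real_inner_le_norm p w
    have h4 := mul_nonneg hβ (hH p)
    linarith
  have h2 : ‖p‖ ≤ L * ‖w‖ := by
    have h3 : ‖p‖ ^ 2 ≤ L * (‖p‖ * ‖w‖) := (hT v).trans (mul_le_mul_of_nonneg_left h1 hL)
    rcases (norm_nonneg p).eq_or_lt with h0 | h0
    · rw [← h0]; positivity
    · refine le_of_mul_le_mul_left ?_ h0
      linarith
  have h3 : v = β • H p - w := by rw [hw']; abel
  have h4 : ‖H p‖ ≤ M * (L * ‖w‖) :=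
    (H.le_opNorm p).trans (mul_le_mul hHM h2 (norm_nonneg _) hM)
  calc ‖v‖ = ‖β • H p - w‖ := by rw [← h3]
    _ ≤ ‖β • H p‖ + ‖w‖ := norm_sub_le _ _
    _ = β * ‖H p‖ + ‖w‖ := by rw [norm_smul, Real.norm_of_nonneg hβ]
    _ ≤ β * (M * (L * ‖w‖)) + ‖w‖ := by gcongr
    _ = _ := by ring

lemma isInvertible_of_norm_le [FiniteDimensional ℝ E] {A : E →L[ℝ] E} {K : ℝ}
    (h : ∀ v, ‖v‖ ≤ K * ‖A v‖) : A.IsInvertible := by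
  have hinj : Function.Injective (A : E →ₗ[ℝ] E) := by
    rw [injective_iff_map_eq_zero]
    intro v hv
    have hv' : A v = 0 := hv
    have := h v
    rw [hv', norm_zero, mul_zero] at this
    exact norm_le_zero_iff.1 this
  refine ⟨(LinearEquiv.ofInjectiveEndo (A : E →ₗ[ℝ] E) hinj).toContinuousLinearEquiv, ?_⟩
  ext v
  rfl

end Invertibility

/-! ### Chain rule for the residual -/

section Residual

variable {n : ℕ} {D : Set Plane} {a : Fin n → Plane} {ϱ : Plane → ℝ} {ud : Measure Plane}
  {g : EuclideanSpace ℝ (Fin n) → ℝ} {α : ℝ} {ξbar : EuclideanSpace ℝ (Fin n)}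

/-- The uniform bound on `Theta` turns the expansion of the masses into a linear growth bound at
`ξbar`, which lets remainders in `uTilde` be read as remainders in `ξ`. -/
lemma uTilde_sub_isBigO {L : ℝ}
    (hT : ∀ ξ v : EuclideanSpace ℝ (Fin n),
      ‖Matrix.toEuclideanCLM (𝕜 := ℝ) (Theta D a ud ϱ ξ) v‖ ≤ L * ‖v‖)
    (hu : (fun ξ => uTilde D a ud ξ - uTilde D a ud ξbar
        - Matrix.toEuclideanCLM (𝕜 := ℝ) (Theta D a ud ϱ ξ) (ξ - ξbar))
      =o[𝓝 ξbar] (fun ξ => ξ - ξbar)) :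
    (fun ξ => uTilde D a ud ξ - uTilde D a ud ξbar) =O[𝓝 ξbar] (fun ξ => ξ - ξbar) := by
  have h1 : (fun ξ => Matrix.toEuclideanCLM (𝕜 := ℝ) (Theta D a ud ϱ ξ) (ξ - ξbar))
      =O[𝓝 ξbar] (fun ξ => ξ - ξbar) :=
    Asymptotics.IsBigO.of_bound L (Eventually.of_forall fun ξ => hT ξ _)
  simpa using hu.isBigO.add h1

lemma continuousAt_uTilde
    (hu : (fun ξ => uTilde D a ud ξ - uTilde D a ud ξbar) =O[𝓝 ξbar] (fun ξ => ξ - ξbar)) :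
    ContinuousAt (uTilde D a ud) ξbar := by
  have h1 : Tendsto (fun ξ : EuclideanSpace ℝ (Fin n) => ξ - ξbar) (𝓝 ξbar) (𝓝 0) := by
    have hc : Continuous fun ξ : EuclideanSpace ℝ (Fin n) => ξ - ξbar := by fun_prop
    simpa using hc.tendsto ξbar
  exact tendsto_sub_nhds_zero_iff.1 (hu.trans_tendsto h1)

/-- Newton differentiability of the residual at a zero. -/
theorem residual_sub_isLittleO (hg : ContDiff ℝ 2 g) (hξbar : residual D a ud g α ξbar = 0) {L : ℝ}
    (hT : ∀ ξ v : EuclideanSpace ℝ (Fin n),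
      ‖Matrix.toEuclideanCLM (𝕜 := ℝ) (Theta D a ud ϱ ξ) v‖ ≤ L * ‖v‖)
    (hu : (fun ξ => uTilde D a ud ξ - uTilde D a ud ξbar
        - Matrix.toEuclideanCLM (𝕜 := ℝ) (Theta D a ud ϱ ξ) (ξ - ξbar))
      =o[𝓝 ξbar] (fun ξ => ξ - ξbar)) :
    (fun ξ => residual D a ud g α ξ - Dr D a ud ϱ g α ξ (ξ - ξbar))
      =o[𝓝 ξbar] (fun ξ => ξ - ξbar) := by
  have hO := uTilde_sub_isBigO hT hu
  have hc := continuousAt_uTilde hO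
  have hgrad := contDiff_gradient hg
  have hcH : Continuous (fderiv ℝ (gradient g)) := hgrad.continuous_fderiv (by norm_num)
  set ubar := uTilde D a ud ξbar with hubar
  have hHt : Tendsto (fun ξ => fderiv ℝ (gradient g) (uTilde D a ud ξ)) (𝓝 ξbar)
      (𝓝 (fderiv ℝ (gradient g) ubar)) := (hcH.tendsto ubar).comp hc
  have e1 : (fun ξ => gradient g (uTilde D a ud ξ) - gradient g ubar
      - fderiv ℝ (gradient g) ubar (uTilde D a ud ξ - ubar)) =o[𝓝 ξbar] (fun ξ => ξ - ξbar) := by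
    have h1 := ((hgrad.differentiable (by norm_num)) ubar).hasFDerivAt.isLittleO
    exact (h1.comp_tendsto hc).trans_isBigO hO
  have e2 : (fun ξ => (fderiv ℝ (gradient g) ubar - fderiv ℝ (gradient g) (uTilde D a ud ξ))
      (uTilde D a ud ξ - ubar)) =o[𝓝 ξbar] (fun ξ => ξ - ξbar) := by
    have h0 : Tendsto (fun ξ => fderiv ℝ (gradient g) ubar
        - fderiv ℝ (gradient g) (uTilde D a ud ξ)) (𝓝 ξbar) (𝓝 0) := by
      simpa using (tendsto_const_nhds (x := fderiv ℝ (gradient g) ubar)).sub hHt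
    have h1 := ((Asymptotics.isLittleO_one_iff ℝ).2 h0).norm_left
    have h2 := h1.mul_isBigO hO.norm_norm
    simp only [one_mul] at h2
    refine Asymptotics.IsBigO.trans_isLittleO (Asymptotics.IsBigO.of_bound 1 ?_) h2.of_norm_right
    refine Eventually.of_forall fun ξ => ?_
    rw [one_mul, norm_mul, norm_norm, norm_norm]
    exact ContinuousLinearMap.le_opNorm _ _
  have e3 : (fun ξ => fderiv ℝ (gradient g) (uTilde D a ud ξ)
      (uTilde D a ud ξ - ubar
        - Matrix.toEuclideanCLM (𝕜 := ℝ) (Theta D a ud ϱ ξ) (ξ - ξbar)))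
      =o[𝓝 ξbar] (fun ξ => ξ - ξbar) := by
    refine Asymptotics.IsBigO.trans_isLittleO
      (Asymptotics.IsBigO.of_bound (‖fderiv ℝ (gradient g) ubar‖ + 1) ?_) hu
    filter_upwards [hHt.norm.eventually (gt_mem_nhds (lt_add_one _))] with ξ hξ
    exact (ContinuousLinearMap.le_opNorm _ _).trans
      (mul_le_mul_of_nonneg_right hξ.le (norm_nonneg _))
  -- The remainders telescope: expand the gradient at `ubar`, exchange the Hessian at `ubar` for the
  -- one at the moving point, then insert the expansion of `uTilde`. Subtracting the zero residual
  -- at `ξbar` removes the constant term.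
  refine (((e1.add e2).add e3).const_smul_left (1 / α)).congr_left fun ξ => ?_
  have hres : residual D a ud g α ξ = residual D a ud g α ξ - residual D a ud g α ξbar := by
    rw [hξbar, sub_zero]
  rw [hres]
  simp only [residual, Dr, Pi.smul_apply, _root_.sub_apply, _root_.smul_apply,
    ContinuousLinearMap.comp_apply, ContinuousLinearMap.id_apply, map_sub, ← hubar]
  module

end Residual

end SemiDiscrete

end

/-! ### Assembly of the convergence theorem -/

theorem mainTheorem3 {n : ℕ}
    (a : Fin n → EuclideanSpace ℝ (Fin 2)) (ha : Function.Injective a)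
    (D : Set (EuclideanSpace ℝ (Fin 2))) (hD : SemiDiscrete.IsConvexPolygon D)
    (g : EuclideanSpace ℝ (Fin n) → ℝ) (hg : ContDiff ℝ 2 g)
    (α : ℝ) (hα : 0 < α)
    (ϱ : EuclideanSpace ℝ (Fin 2) → ℝ) (hϱ : ContinuousOn ϱ D) (hϱ_nonneg : ∀ x ∈ D, 0 ≤ ϱ x)
    (ud : MeasureTheory.Measure (EuclideanSpace ℝ (Fin 2)))
    (hud : ud = (MeasureTheory.volume.restrict D).withDensity fun x => ENNReal.ofReal (ϱ x))
    (hg_convex : ConvexOn ℝ Set.univ g)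
    (ξbar : EuclideanSpace ℝ (Fin n)) (hξbar : SemiDiscrete.residual D a ud g α ξbar = 0) :
    ∃ δ : ℝ, 0 < δ ∧ ∀ ξ₀ : EuclideanSpace ℝ (Fin n), ‖ξ₀ - ξbar‖ ≤ δ →
      (∀ k, (SemiDiscrete.Dr D a ud ϱ g α
        (SemiDiscrete.newtonSeq D a ud ϱ g α ξ₀ k)).IsInvertible) ∧
      SemiDiscrete.ConvergesQSuperlinearly (SemiDiscrete.newtonSeq D a ud ϱ g α ξ₀) ξbar := by
  obtain ⟨ρ, hρ, hs, hEq⟩ := SemiDiscrete.exists_compactSupport_extension hD.1 hϱ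
  have hu := SemiDiscrete.uTilde_sub_isLittleO ha hD hEq hρ hs hϱ_nonneg hud ξbar
  obtain ⟨L, hL, hco⟩ :=
    SemiDiscrete.exists_Theta_cocoercive ha hD.1.isClosed hEq hρ hs hϱ_nonneg hud
  have hT : ∀ ξ v : EuclideanSpace ℝ (Fin n),
      ‖Matrix.toEuclideanCLM (𝕜 := ℝ) (SemiDiscrete.Theta D a ud ϱ ξ) v‖ ≤ L * ‖v‖ := by
    intro ξ v
    set p := Matrix.toEuclideanCLM (𝕜 := ℝ) (SemiDiscrete.Theta D a ud ϱ ξ) v with hp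
    have h1 : -inner ℝ p v ≤ ‖p‖ * ‖v‖ := (neg_le_abs _).trans (abs_real_inner_le_norm p v)
    have h2 : ‖p‖ ^ 2 ≤ L * (‖p‖ * ‖v‖) :=
      (hco ξ v).trans (mul_le_mul_of_nonneg_left h1 hL)
    rcases (norm_nonneg p).eq_or_lt with h0 | h0
    · rw [← h0]; positivity
    · refine le_of_mul_le_mul_left ?_ h0
      linarith
  have hlo := SemiDiscrete.residual_sub_isLittleO hg hξbar hT hu
  have hcH : Continuous (fderiv ℝ (gradient g)) :=
    (SemiDiscrete.contDiff_gradient hg).continuous_fderiv (by norm_num)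
  have hHt : Tendsto (fun ξ => fderiv ℝ (gradient g) (SemiDiscrete.uTilde D a ud ξ)) (𝓝 ξbar)
      (𝓝 (fderiv ℝ (gradient g) (SemiDiscrete.uTilde D a ud ξbar))) :=
    (hcH.tendsto _).comp
      (SemiDiscrete.continuousAt_uTilde (SemiDiscrete.uTilde_sub_isBigO hT hu))
  -- Continuity of `uTilde` at `ξbar` bounds the nearby Hessians by the norm at `ξbar` plus `1`, so
  -- one constant serves a whole neighbourhood.
  have hinv : ∀ᶠ ξ in 𝓝 ξbar, (SemiDiscrete.Dr D a ud ϱ g α ξ).IsInvertible ∧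
      ∀ v, ‖v‖ ≤ (1 + 1 / α
        * (‖fderiv ℝ (gradient g) (SemiDiscrete.uTilde D a ud ξbar)‖ + 1) * L)
        * ‖SemiDiscrete.Dr D a ud ϱ g α ξ v‖ := by
    filter_upwards [hHt.norm.eventually (gt_mem_nhds (lt_add_one _))] with ξ hξ
    have hbd := SemiDiscrete.norm_le_of_cocoercive (β := 1 / α) (by positivity) hL
      (SemiDiscrete.inner_hessian_nonneg hg hg_convex (SemiDiscrete.uTilde D a ud ξ)) hξ.le
      (hco ξ)
    exact ⟨SemiDiscrete.isInvertible_of_norm_le hbd, hbd⟩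
  obtain ⟨δ, hδ, h⟩ := SemiDiscrete.newton_convergesQSuperlinearly hinv hlo
  exact ⟨δ, hδ, fun ξ₀ hξ₀ =>
    h (SemiDiscrete.newtonSeq D a ud ϱ g α ξ₀) hξ₀ fun _ => rfl⟩
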